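/- Method 2 (Exchanging Steklov-equivalent subgraphs). A (finite compact) metric graph $\Gamma$ is a finite collection of intervals $[0,\ell_e]$, $\ell_e>0$ (the edges), whose end points are joined together at vertices, the classes of a partition of the set of all end points. For a function $u$ on $\Gamma$ and a vertex $V$ let $\partial u(V)$ be the sum over all end points in $V$ of the derivatives of $u$ taken in the direction into the edge. The standard Laplacian $L$ acts as $-u''$ in $L_2(\Gamma)=\bigoplus_e L_2(0,\ell_e)$, on the functions $u\in\bigoplus_e W_2^2(0,\ell_e)$ that are continuous at all vertices and satisfy $\partial u(V)=0$ at every vertex $V$. Two metric graphs are isospectral if their standard Laplacians have the same spectrum, and every eigenvalue has the same multiplicity for both. For a metric graph $R$ with a chosen set $\partial R=\{c(b)\}_{b\in B}$ of distinct contact vertices and for non-real $\lambda$, the Titchmarsh–Weyl $M$-function $\mathbb M_R(\lambda):\mathbb C^B\to\mathbb C^B$ maps $(u(c(b)))_{b\in B}$ to $(\partial u(c(b)))_{b\in B}$, where $u$ is a solution of $-u''=\lambda u$ on the edges of $R$ which is continuous on $R$ and satisfies $\partial u(V)=0$ at all vertices $V\notin\partial R$. Let $\Gamma$ be a metric graph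 that contains two subgraphs $R_1$ and $R_2$ without common edges, with contact vertices $c_1(b)$ and $c_2(b)$, $b\in B$, indexed by the same set $B$. Each $R_i$ meets the rest of $\Gamma$ only in its contact vertices, that is, in $\Gamma$ only contact vertices of $R_i$ may be joined to end points of other edges or to one another. Assume that $$\mathbb M_{R_1}(\lambda)=\mathbb M_{R_2}(\lambda)\qquad\text{for all non-real }\lambda .$$ Let $\Gamma'$ be the metric graph obtained by exchanging $R_1$ and $R_2$ in $\Gamma$: both subgraphs are cut off at their contact vertices, and for every $b\in B$ the contact vertex $c_1(b)$ of $R_1$ is attached where $c_2(b)$ was attached in $\Gamma$, and conversely. Then $\Gamma'$ is isospectral to $\Gamma$. It is not assumed that $R_1$ and $R_2$ are isospectral. -/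

import Mathlib

open MeasureTheory

/-- A finite compact metric graph with edge set `E` and vertex set `V`. The edge `e` is the interval
`[0, length e]`. The end points are the elements of `E × Bool`: `(e, false)` is the left end point `0`
and `(e, true)` is the right end point `length e` of the edge `e`. The vertices are the classes of the
partition of the end points given by `vert`; they are non-empty, hence `vert` is surjective.
Loops, multiple edges and disconnected graphs are allowed. -/
structure MetricGraph (E V : Type*) where
  length : E → ℝ
  length_pos : ∀ e, 0 < length e
  vert : E × Bool → V
  vert_surjective : Function.Surjective vert

/-- `u` belongs to the Sobolev space `W₂²(0, ℓ)` and `u'' = v`: the function `u` is differentiable on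
`[0, ℓ]`, and `u'` is absolutely continuous with derivative `v ∈ L₂(0, ℓ)`. -/
structure IsW22 (ℓ : ℝ) (u v : ℝ → ℂ) : Prop where
  differentiableOn : DifferentiableOn ℝ u (Set.Icc 0 ℓ)
  memLp : MemLp v 2 (volume.restrict (Set.Icc 0 ℓ))
  deriv_eq : ∀ x ∈ Set.Icc 0 ℓ, derivWithin u (Set.Icc 0 ℓ) x =
    derivWithin u (Set.Icc 0 ℓ) 0 + ∫ t in (0 : ℝ)..x, v t

theorem IsW22.add {ℓ : ℝ} (hℓ : 0 < ℓ) {u v u' v' : ℝ → ℂ} (h : IsW22 ℓ u v) (h' : IsW22 ℓ u' v') :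
    IsW22 ℓ (u + u') (v + v') := by
  have h0 : (0 : ℝ) ∈ Set.Icc 0 ℓ := ⟨le_rfl, hℓ.le⟩
  have hd : ∀ x ∈ Set.Icc 0 ℓ, derivWithin (u + u') (Set.Icc 0 ℓ) x =
      derivWithin u (Set.Icc 0 ℓ) x + derivWithin u' (Set.Icc 0 ℓ) x := fun x hx =>
    derivWithin_add (h.differentiableOn x hx) (h'.differentiableOn x hx)
  have hi : ∀ w : ℝ → ℂ, MemLp w 2 (volume.restrict (Set.Icc 0 ℓ)) → ∀ x ∈ Set.Icc 0 ℓ,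
      IntervalIntegrable w volume 0 x := by
    intro w hw x hx
    rw [intervalIntegrable_iff_integrableOn_Icc_of_le hx.1]
    exact IntegrableOn.mono_set (hw.integrable (by norm_num)) (Set.Icc_subset_Icc_right hx.2)
  refine ⟨h.differentiableOn.add h'.differentiableOn, h.memLp.add h'.memLp, fun x hx => ?_⟩
  rw [hd x hx, hd 0 h0, h.deriv_eq x hx, h'.deriv_eq x hx]
  simp only [Pi.add_apply]
  rw [intervalIntegral.integral_add (hi v h.memLp x hx) (hi v' h'.memLp x hx)]
  ring

theorem IsW22.const_smul {ℓ : ℝ} {u v : ℝ → ℂ} (h : IsW22 ℓ u v) (c : ℂ) :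
    IsW22 ℓ (c • u) (c • v) := by
  refine ⟨h.differentiableOn.const_smul c, h.memLp.const_smul c, fun x hx => ?_⟩
  rw [derivWithin_const_smul_field, derivWithin_const_smul_field, h.deriv_eq x hx]
  simp only [Pi.smul_apply, smul_add, intervalIntegral.integral_smul]

theorem IsW22.congr_ae {ℓ : ℝ} {u v w : ℝ → ℂ} (h : IsW22 ℓ u v)
    (hvw : v =ᵐ[volume.restrict (Set.Icc 0 ℓ)] w) : IsW22 ℓ u w := by
  refine ⟨h.differentiableOn, h.memLp.ae_eq hvw, fun x hx => ?_⟩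
  rw [h.deriv_eq x hx]
  congr 1
  apply intervalIntegral.integral_congr_ae_restrict
  rw [Set.uIoc_of_le hx.1]
  have hsub : Set.Ioc 0 x ⊆ Set.Icc 0 ℓ := fun t ht => ⟨ht.1.le, ht.2.trans hx.2⟩
  exact ae_restrict_of_ae_restrict_of_subset hsub hvw

namespace MetricGraph

section Functions

variable {E V B : Type*} (Γ : MetricGraph E V)

/-- The value of a function `u` on the edges at an end point. Only the values of `u e` on the interval
`[0, length e]` matter, here and below. -/
def endValue (u : E → ℝ → ℂ) (x : E × Bool) : ℂ :=
  u x.1 (if x.2 then Γ.length x.1 else 0)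

/-- The oriented derivative of `u` at an end point: `u'` at left end points and `-u'` at right ones. -/
noncomputable def endDeriv (u : E → ℝ → ℂ) (x : E × Bool) : ℂ :=
  if x.2 then -derivWithin (u x.1) (Set.Icc 0 (Γ.length x.1)) (Γ.length x.1)
  else derivWithin (u x.1) (Set.Icc 0 (Γ.length x.1)) 0

theorem endDeriv_add {u w : E → ℝ → ℂ}
    (hu : ∀ e, DifferentiableOn ℝ (u e) (Set.Icc 0 (Γ.length e)))
    (hw : ∀ e, DifferentiableOn ℝ (w e) (Set.Icc 0 (Γ.length e))) (x : E × Bool) :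
    Γ.endDeriv (u + w) x = Γ.endDeriv u x + Γ.endDeriv w x := by
  have hl := (Γ.length_pos x.1).le
  have h0 := derivWithin_add (hu x.1 0 ⟨le_rfl, hl⟩) (hw x.1 0 ⟨le_rfl, hl⟩)
  have h1 := derivWithin_add (hu x.1 _ ⟨hl, le_rfl⟩) (hw x.1 _ ⟨hl, le_rfl⟩)
  unfold endDeriv
  split_ifs
  · rw [Pi.add_apply, h1, neg_add]
  · rw [Pi.add_apply, h0]

theorem endDeriv_smul (c : ℂ) (u : E → ℝ → ℂ) (x : E × Bool) :
    Γ.endDeriv (c • u) x = c * Γ.endDeriv u x := by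
  unfold endDeriv
  split_ifs <;> simp [Pi.smul_apply, derivWithin_const_smul_field]

open Classical in
/-- `∂u(v)`: the sum of the oriented derivatives of `u` over all end points in the vertex `v`. -/
noncomputable def vertexDeriv [Fintype E] (u : E → ℝ → ℂ) (v : V) : ℂ :=
  ∑ x : E × Bool with Γ.vert x = v, Γ.endDeriv u x

/-- `u` takes the same value at all end points that belong to the same vertex. -/
def ContinuousAtVertices (u : E → ℝ → ℂ) : Prop :=
  ∀ x y, Γ.vert x = Γ.vert y → Γ.endValue u x = Γ.endValue u y

/-- `u` solves `-u'' = z u` on every edge, is continuous on the whole graph, and satisfies the standard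
(continuity and Kirchhoff) conditions at all vertices that are not contact vertices `c b`. -/
def IsSolution [Fintype E] (c : B ↪ V) (z : ℂ) (u : E → ℝ → ℂ) : Prop :=
  (∀ e, IsW22 (Γ.length e) (u e) (fun x => -(z * u e x))) ∧
    Γ.ContinuousAtVertices u ∧
    ∀ v, v ∉ Set.range c → Γ.vertexDeriv u v = 0

/-- `u` has the boundary values `f` on the contact vertices. -/
def HasBoundaryValues (c : B ↪ V) (u : E → ℝ → ℂ) (f : B → ℂ) : Prop :=
  ∀ x b, Γ.vert x = c b → Γ.endValue u x = f b

open Classical in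
/-- The Titchmarsh-Weyl `M`-function of `Γ` with contact vertices `c b`, `b : B`, at the point `z`:
the map sending the boundary values `(u (c b))_b` of a solution `u` of `-u'' = z u` to the boundary
derivatives `(∂u (c b))_b`. For non-real `z` the solution with given boundary values exists and is
unique on the edges. -/
noncomputable def mFunction [Fintype E] (c : B ↪ V) (z : ℂ) (f : B → ℂ) : B → ℂ :=
  if h : ∃ u, Γ.IsSolution c z u ∧ Γ.HasBoundaryValues c u f then
    fun b => Γ.vertexDeriv h.choose (c b)
  else 0

end Functions

section Laplacian

variable {E V : Type*} [Fintype E] (Γ : MetricGraph E V)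

/-- The Hilbert space `L₂(Γ)`, the orthogonal sum of the spaces `L₂(0, length e)`. -/
abbrev L2 : Type _ := PiLp 2 fun e : E => Lp ℂ 2 (volume.restrict (Set.Icc 0 (Γ.length e)))

/-- `f` lies in the domain of the standard Laplacian `L` on `Γ` and `L f = g`: the class `f` is
represented by a function `u`, in `W₂²` on every edge, that is continuous at the vertices and satisfies
the Kirchhoff condition at every vertex, and `-u'' = g`. -/
def IsLaplacian (f g : Γ.L2) : Prop :=
  ∃ u : E → ℝ → ℂ,
    (∀ e, u e =ᵐ[volume.restrict (Set.Icc 0 (Γ.length e))] f e) ∧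
    (∀ e, IsW22 (Γ.length e) (u e) (fun x => -(g e x))) ∧
    Γ.ContinuousAtVertices u ∧
    ∀ v, Γ.vertexDeriv u v = 0

/-- The graph of the standard Laplacian `L` on `Γ`, a subspace of `L₂(Γ) × L₂(Γ)`. -/
noncomputable def laplacianGraph : Submodule ℂ (Γ.L2 × Γ.L2) where
  carrier := {p | Γ.IsLaplacian p.1 p.2}
  zero_mem' := by
    refine ⟨0, fun e => ?_, fun e => ?_, fun x y _ => rfl, fun v => ?_⟩
    · exact (Lp.coeFn_zero _ _ _).symm
    · have h : IsW22 (Γ.length e) 0 0 :=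
        ⟨differentiableOn_const 0, MemLp.zero, fun x _ => by simp⟩
      refine h.congr_ae ?_
      filter_upwards [Lp.coeFn_zero ℂ 2 (volume.restrict (Set.Icc 0 (Γ.length e)))] with x hx
      have hx' : ((0 : Γ.L2 × Γ.L2).2 e) x = 0 := hx
      change (0 : ℂ) = -(((0 : Γ.L2 × Γ.L2).2 e) x)
      rw [hx', neg_zero]
    · unfold vertexDeriv
      refine Finset.sum_eq_zero fun x _ => ?_
      unfold endDeriv
      split_ifs <;> simp
  add_mem' := by
    rintro ⟨f, g⟩ ⟨f', g'⟩ ⟨u, hu1, hu2, hu3, hu4⟩ ⟨w, hw1, hw2, hw3, hw4⟩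
    refine ⟨u + w, fun e => ?_, fun e => ?_, fun x y hxy => ?_, fun v => ?_⟩
    · exact ((hu1 e).add (hw1 e)).trans (Lp.coeFn_add (f e) (f' e)).symm
    · refine ((hu2 e).add (Γ.length_pos e) (hw2 e)).congr_ae ?_
      filter_upwards [Lp.coeFn_add (g e) (g' e)] with x hx
      have hx' : (((f, g) + (f', g')).2 e) x = g e x + g' e x := hx
      simp only [Pi.add_apply, hx']
      ring
    · exact congrArg₂ (· + ·) (hu3 x y hxy) (hw3 x y hxy)
    · have h : ∀ x, Γ.endDeriv (u + w) x = Γ.endDeriv u x + Γ.endDeriv w x :=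
        Γ.endDeriv_add (fun e => (hu2 e).differentiableOn) (fun e => (hw2 e).differentiableOn)
      have h1 := hu4 v
      have h2 := hw4 v
      unfold vertexDeriv at h1 h2 ⊢
      simp only [h, Finset.sum_add_distrib, h1, h2, add_zero]
  smul_mem' := by
    rintro c ⟨f, g⟩ ⟨u, hu1, hu2, hu3, hu4⟩
    refine ⟨c • u, fun e => ?_, fun e => ?_, fun x y hxy => ?_, fun v => ?_⟩
    · exact ((hu1 e).const_smul c).trans (Lp.coeFn_smul c (f e)).symm
    · refine ((hu2 e).const_smul c).congr_ae ?_
      filter_upwards [Lp.coeFn_smul c (g e)] with x hx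
      have hx' : ((c • (f, g)).2 e) x = c * g e x := hx
      simp only [Pi.smul_apply, smul_eq_mul, hx']
      ring
    · exact congrArg (c * ·) (hu3 x y hxy)
    · have h1 := hu4 v
      unfold vertexDeriv at h1 ⊢
      simp only [endDeriv_smul, ← Finset.mul_sum, h1, mul_zero]

/-- The eigenspace `ker (L - z)` of the standard Laplacian. -/
noncomputable def eigenspace (z : ℂ) : Submodule ℂ Γ.L2 :=
  Γ.laplacianGraph.comap (LinearMap.id.prod (z • LinearMap.id))

/-- The spectrum of the standard Laplacian `L` as a set: the points `z` for which `L - z` is not a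
bijection of the domain of `L` onto `L₂(Γ)`. (The operator `L` is closed, so the inverse of a bijective
`L - z` is bounded.) -/
def spectrum : Set ℂ :=
  {z | ¬ ∀ h : Γ.L2, ∃! f : Γ.L2, (f, z • f + h) ∈ Γ.laplacianGraph}

end Laplacian

/-- Two metric graphs are isospectral if their standard Laplacians have the same spectrum, and every
point has the same multiplicity as an eigenvalue. -/
def Isospectral.{uE, uV, uE', uV'} {E : Type uE} {V : Type uV} {E' : Type uE'} {V' : Type uV'}
    [Fintype E] [Fintype E'] (Γ : MetricGraph E V) (Γ' : MetricGraph E' V') : Prop :=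
  Γ.spectrum = Γ'.spectrum ∧
    ∀ z : ℂ, Cardinal.lift.{uE'} (Module.rank ℂ (Γ.eigenspace z)) =
      Cardinal.lift.{uE} (Module.rank ℂ (Γ'.eigenspace z))

/-- The metric graph `R` with contact vertices `c b`, `b : B`, is a subgraph of `Γ`: the edges of `R`
are edges of `Γ`, the vertices of `R` go to vertices of `Γ`, and `R` meets the rest of `Γ` only in
contact vertices. That is, the vertex of `Γ` given by a non-contact vertex `w` of `R` consists of the
end points in `w` only, whereas a contact vertex may be joined in `Γ` to end points of other edges
(and to other contact vertices of `R`). -/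
structure Inclusion {E V E' V' B : Type*} (R : MetricGraph E' V') (c : B ↪ V')
    (Γ : MetricGraph E V) where
  edge : E' ↪ E
  length_edge : ∀ e, Γ.length (edge e) = R.length e
  vertex : V' → V
  vert_edge : ∀ e s, Γ.vert (edge e, s) = vertex (R.vert (e, s))
  inner : ∀ w, w ∉ Set.range c → ∀ x : E × Bool, Γ.vert x = vertex w →
    ∃ e s, (edge e, s) = x ∧ R.vert (e, s) = w

section Exchange

variable {E V E₁ V₁ E₂ V₂ B : Type*} {Γ : MetricGraph E V}
  {R₁ : MetricGraph E₁ V₁} {c₁ : B ↪ V₁} {R₂ : MetricGraph E₂ V₂} {c₂ : B ↪ V₂}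

/-- The end point `x` of `Γ` is an end point of the subgraph lying in its contact vertex `b`. -/
def Inclusion.AtContact (ι : Inclusion R₁ c₁ Γ) (x : E × Bool) (b : B) : Prop :=
  ∃ e s, (ι.edge e, s) = x ∧ R₁.vert (e, s) = c₁ b

theorem Inclusion.AtContact.unique {ι : Inclusion R₁ c₁ Γ} {x : E × Bool} {b b' : B}
    (h : ι.AtContact x b) (h' : ι.AtContact x b') : b = b' := by
  obtain ⟨e, s, rfl, h⟩ := h
  obtain ⟨e', s', hx, h'⟩ := h'
  obtain ⟨h1, rfl⟩ := Prod.mk.inj hx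
  obtain rfl := ι.edge.injective h1
  exact c₁.injective (h.symm.trans h')

theorem Inclusion.AtContact.vert_eq {ι : Inclusion R₁ c₁ Γ} {x : E × Bool} {b : B}
    (h : ι.AtContact x b) : Γ.vert x = ι.vertex (c₁ b) := by
  obtain ⟨e, s, rfl, h⟩ := h
  rw [ι.vert_edge, h]

open Classical in
/-- The vertex of an end point after the exchange of the two subgraphs: `R₁` and `R₂` are cut off at
their contact vertices, and the contact vertex `c₁ b` of `R₁` is attached where `c₂ b` was attached,
and conversely. All other end points stay where they are. -/
noncomputable def exchangeVert (ι₁ : Inclusion R₁ c₁ Γ) (ι₂ : Inclusion R₂ c₂ Γ) (x : E × Bool) : V :=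
  if h : ∃ b, ι₁.AtContact x b then ι₂.vertex (c₂ h.choose)
  else if h : ∃ b, ι₂.AtContact x b then ι₁.vertex (c₁ h.choose)
  else Γ.vert x

theorem exchangeVert_left (ι₁ : Inclusion R₁ c₁ Γ) (ι₂ : Inclusion R₂ c₂ Γ) {x : E × Bool} {b : B}
    (h : ι₁.AtContact x b) : exchangeVert ι₁ ι₂ x = ι₂.vertex (c₂ b) := by
  have hx : ∃ b, ι₁.AtContact x b := ⟨b, h⟩
  rw [exchangeVert, dif_pos hx, hx.choose_spec.unique h]

theorem exchangeVert_right (ι₁ : Inclusion R₁ c₁ Γ) (ι₂ : Inclusion R₂ c₂ Γ)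
    (hdisj : ∀ e₁ e₂, ι₁.edge e₁ ≠ ι₂.edge e₂) {x : E × Bool} {b : B}
    (h : ι₂.AtContact x b) : exchangeVert ι₁ ι₂ x = ι₁.vertex (c₁ b) := by
  have hx : ∃ b, ι₂.AtContact x b := ⟨b, h⟩
  have hx' : ¬ ∃ b, ι₁.AtContact x b := by
    rintro ⟨b', e, s, rfl, -⟩
    obtain ⟨e', s', h', -⟩ := h
    exact hdisj e e' (Prod.mk.inj h').1.symm
  rw [exchangeVert, dif_neg hx', dif_pos hx, hx.choose_spec.unique h]

/-- The metric graph obtained from `Γ` by exchanging the edge-disjoint subgraphs `R₁` and `R₂`. -/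
noncomputable def exchange (ι₁ : Inclusion R₁ c₁ Γ) (ι₂ : Inclusion R₂ c₂ Γ)
    (hdisj : ∀ e₁ e₂, ι₁.edge e₁ ≠ ι₂.edge e₂) : MetricGraph E V where
  length := Γ.length
  length_pos := Γ.length_pos
  vert := exchangeVert ι₁ ι₂
  vert_surjective := by
    intro v
    obtain ⟨x, rfl⟩ := Γ.vert_surjective v
    by_cases h₁ : ∃ b, ι₁.AtContact x b
    · obtain ⟨b, hb⟩ := h₁
      obtain ⟨⟨e, s⟩, hy⟩ := R₂.vert_surjective (c₂ b)
      exact ⟨(ι₂.edge e, s), by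
        rw [exchangeVert_right ι₁ ι₂ hdisj ⟨e, s, rfl, hy⟩, hb.vert_eq]⟩
    · by_cases h₂ : ∃ b, ι₂.AtContact x b
      · obtain ⟨b, hb⟩ := h₂
        obtain ⟨⟨e, s⟩, hy⟩ := R₁.vert_surjective (c₁ b)
        exact ⟨(ι₁.edge e, s), by
          rw [exchangeVert_left ι₁ ι₂ ⟨e, s, rfl, hy⟩, hb.vert_eq]⟩
      · exact ⟨x, by rw [exchangeVert, dif_neg h₁, dif_neg h₂]⟩

end Exchange

end MetricGraph

/-! The proof compares, for every complex `z`, the finite-dimensional spaces of solutions of `-u'' =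
z u` with standard vertex conditions on the two graphs. Solutions are encoded by their initial data
on the edges. Such a space is isomorphic to the eigenspace at `z` (`eigenspace_eq_map`), and a
Fredholm alternative shows that the spectrum consists of eigenvalues only (`mem_spectrum_iff`). It
therefore suffices to find, for each `z`, an isomorphism between the two solution spaces.

The core is that `R₁` and `R₂` have the same set of boundary data (contact values, contact
derivatives) for every `z`. For non-real `z` this set is the graph of the `M`-function. At a real
`z` the `M`-function may have a pole, and the set need not be a graph. There one approaches `z`
along `z + iε` with fixed contact values. Green's identity bounds the `L₂` norms of the solutions by
the norm of a solution at `z` (`solNormSq_le_of_contactData_fst_eq`), so a subsequence converges,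
and each contact value of one subgraph is attained by a pair of data common to both
(`exists_common_contactData`). The remaining data have zero contact values. They are controlled by
symplectic duality: data spaces are isotropic by Green's identity (`sum_contactData`) and maximal
with this property (`exists_contactData_eq`), which forces equality
(`exists_contactData_eq_of_real`).

Given equal data spaces, a solution on the old graph is turned into one on the new graph by adding
to it on `R₁` and `R₂` solutions that interchange its two boundary data; elsewhere it is unchanged
(`IsExchange.mem_solSpace`). The corrections depend linearly on the difference of the two data, and
this difference changes sign under the interchange. Hence the map is an involution (`exists_swap`).
Since the solution is corrected and not replaced, eigenfunctions of a subgraph with zero contact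
data stay where they are, and so `R₁` and `R₂` need not be isospectral. -/

/-! ### The equation `-u'' = z u` on an interval. -/

/-- The generator of the first order system for `(u, u')` equivalent to `-u'' = z u`. -/
noncomputable def odeGenerator (z : ℂ) : (ℂ × ℂ) →L[ℂ] (ℂ × ℂ) :=
  (ContinuousLinearMap.snd ℂ ℂ ℂ).prod (-(z • ContinuousLinearMap.fst ℂ ℂ ℂ))

/-- The propagator `(u 0, u' 0) ↦ (u x, u' x)` of the equation `-u'' = z u`. -/
noncomputable def propagator (z : ℂ) (x : ℝ) : (ℂ × ℂ) →L[ℂ] (ℂ × ℂ) :=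
  NormedSpace.exp ((x : ℂ) • odeGenerator z)

theorem odeGenerator_apply (z : ℂ) (p : ℂ × ℂ) : odeGenerator z p = (p.2, -(z * p.1)) := by
  simp [odeGenerator]

theorem continuous_odeGenerator : Continuous odeGenerator := by
  have h : odeGenerator = fun z : ℂ => (ContinuousLinearMap.inl ℂ ℂ ℂ).comp (ContinuousLinearMap.snd ℂ ℂ ℂ)
      + z • -(ContinuousLinearMap.inr ℂ ℂ ℂ).comp (ContinuousLinearMap.fst ℂ ℂ ℂ) := by
    funext z
    ext <;> simp [odeGenerator]
  rw [h]
  fun_prop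

/-- Joint continuity in `z` and `x` is what later permits limits in the spectral parameter. -/
theorem continuous_propagator : Continuous fun q : ℂ × ℝ => propagator q.1 q.2 := by
  unfold propagator
  have h := continuous_odeGenerator
  let := NormedAlgebra.restrictScalars ℚ ℂ ((ℂ × ℂ) →L[ℂ] (ℂ × ℂ))
  exact (NormedSpace.exp_continuous).comp (by fun_prop)

section Exp

variable {𝔸 : Type*} [NormedRing 𝔸] [NormedAlgebra ℂ 𝔸]

theorem exp_zero_ofReal_smul (a : 𝔸) : NormedSpace.exp (((0 : ℝ) : ℂ) • a) = 1 := by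
  rw [Complex.ofReal_zero, zero_smul, NormedSpace.exp_zero]

variable [CompleteSpace 𝔸]

theorem exp_ofReal_smul_mul_neg (a : 𝔸) (x : ℝ) :
    NormedSpace.exp ((x : ℂ) • a) * NormedSpace.exp (((-x : ℝ) : ℂ) • a) = 1 := by
  let := NormedAlgebra.restrictScalars ℚ ℂ 𝔸
  rw [Complex.ofReal_neg, neg_smul,
    ← NormedSpace.exp_add_of_commute (Commute.neg_right (Commute.refl _)), add_neg_cancel,
    NormedSpace.exp_zero]

theorem hasDerivAt_exp_ofReal_smul (a : 𝔸) (x : ℝ) :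
    HasDerivAt (fun x : ℝ => NormedSpace.exp ((x : ℂ) • a))
      (a * NormedSpace.exp ((x : ℂ) • a)) x :=
  ((hasDerivAt_exp_smul_const' (𝕂 := ℂ) a (x : ℂ)).scomp x
    Complex.ofRealCLM.hasDerivAt).congr_deriv (by simp)

theorem hasDerivAt_exp_neg_ofReal_smul (a : 𝔸) (x : ℝ) :
    HasDerivAt (fun x : ℝ => NormedSpace.exp (((-x : ℝ) : ℂ) • a))
      (-(NormedSpace.exp (((-x : ℝ) : ℂ) • a) * a)) x := by
  have h : HasDerivAt (fun x : ℝ => ((-x : ℝ) : ℂ)) (((-1 : ℝ) : ℝ) : ℂ) x :=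
    (hasDerivAt_neg x).ofReal_comp
  have h' := (hasDerivAt_exp_smul_const (𝕂 := ℂ) a ((-x : ℝ) : ℂ)).scomp x h
  refine h'.congr_deriv ?_
  rw [Complex.ofReal_neg, Complex.ofReal_one, neg_one_smul]

end Exp

theorem propagator_zero (z : ℂ) : propagator z 0 = 1 :=
  exp_zero_ofReal_smul (odeGenerator z)

theorem propagator_mul_neg (z : ℂ) (x : ℝ) : propagator z x * propagator z (-x) = 1 :=
  exp_ofReal_smul_mul_neg (odeGenerator z) x

theorem propagator_apply_neg (z : ℂ) (x : ℝ) (p : ℂ × ℂ) :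
    propagator z x (propagator z (-x) p) = p :=
  congrArg (fun T : (ℂ × ℂ) →L[ℂ] (ℂ × ℂ) => T p) (propagator_mul_neg z x)

theorem hasDerivAt_propagator (z : ℂ) (x : ℝ) :
    HasDerivAt (propagator z) (odeGenerator z * propagator z x) x :=
  hasDerivAt_exp_ofReal_smul (odeGenerator z) x

theorem hasDerivAt_propagator_neg (z : ℂ) (x : ℝ) :
    HasDerivAt (fun x => propagator z (-x)) (-(propagator z (-x) * odeGenerator z)) x :=
  hasDerivAt_exp_neg_ofReal_smul (odeGenerator z) x

/-- The solution of `-u'' = z u` with initial data `(u 0, u' 0) = p`. -/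
noncomputable def sol (z : ℂ) (p : ℂ × ℂ) (x : ℝ) : ℂ := (propagator z x p).1

/-- The derivative of the solution of `-u'' = z u` with initial data `(u 0, u' 0) = p`. -/
noncomputable def dsol (z : ℂ) (p : ℂ × ℂ) (x : ℝ) : ℂ := (propagator z x p).2

theorem sol_zero (z : ℂ) (p : ℂ × ℂ) : sol z p 0 = p.1 := by simp [sol, propagator_zero]

theorem dsol_zero (z : ℂ) (p : ℂ × ℂ) : dsol z p 0 = p.2 := by simp [dsol, propagator_zero]

theorem hasDerivAt_propagator_apply (z : ℂ) (p : ℂ × ℂ) (x : ℝ) :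
    HasDerivAt (fun x => propagator z x p) (odeGenerator z (propagator z x p)) x := by
  have h := ((ContinuousLinearMap.apply ℂ (ℂ × ℂ) p).restrictScalars ℝ).hasFDerivAt.comp_hasDerivAt x
    (hasDerivAt_propagator z x)
  exact h

theorem HasDerivAt.fst_apply {f : ℝ → ℂ × ℂ} {f' : ℂ × ℂ} {x : ℝ} (h : HasDerivAt f f' x) :
    HasDerivAt (fun x => (f x).1) f'.1 x :=
  (ContinuousLinearMap.fst ℝ ℂ ℂ).hasFDerivAt.comp_hasDerivAt x h

theorem HasDerivAt.snd_apply {f : ℝ → ℂ × ℂ} {f' : ℂ × ℂ} {x : ℝ} (h : HasDerivAt f f' x) :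
    HasDerivAt (fun x => (f x).2) f'.2 x :=
  (ContinuousLinearMap.snd ℝ ℂ ℂ).hasFDerivAt.comp_hasDerivAt x h

theorem hasDerivAt_sol (z : ℂ) (p : ℂ × ℂ) (x : ℝ) : HasDerivAt (sol z p) (dsol z p x) x := by
  have h := (hasDerivAt_propagator_apply z p x).fst_apply
  rwa [odeGenerator_apply] at h

theorem hasDerivAt_dsol (z : ℂ) (p : ℂ × ℂ) (x : ℝ) :
    HasDerivAt (dsol z p) (-(z * sol z p x)) x := by
  have h := (hasDerivAt_propagator_apply z p x).snd_apply
  rwa [odeGenerator_apply] at h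

theorem continuous_sol : Continuous fun q : (ℂ × (ℂ × ℂ)) × ℝ => sol q.1.1 q.1.2 q.2 := by
  unfold sol
  have h : Continuous fun q : (ℂ × (ℂ × ℂ)) × ℝ => propagator q.1.1 q.2 :=
    continuous_propagator.comp (f := fun q : (ℂ × (ℂ × ℂ)) × ℝ => (q.1.1, q.2)) (by fun_prop)
  exact (h.clm_apply (by fun_prop)).fst

theorem continuous_dsol : Continuous fun q : (ℂ × (ℂ × ℂ)) × ℝ => dsol q.1.1 q.1.2 q.2 := by
  unfold dsol
  have h : Continuous fun q : (ℂ × (ℂ × ℂ)) × ℝ => propagator q.1.1 q.2 :=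
    continuous_propagator.comp (f := fun q : (ℂ × (ℂ × ℂ)) × ℝ => (q.1.1, q.2)) (by fun_prop)
  exact (h.clm_apply (by fun_prop)).snd

theorem derivWithin_sol {ℓ : ℝ} (hℓ : 0 < ℓ) (z : ℂ) (p : ℂ × ℂ) {x : ℝ} (hx : x ∈ Set.Icc 0 ℓ) :
    derivWithin (sol z p) (Set.Icc 0 ℓ) x = dsol z p x :=
  (hasDerivAt_sol z p x).hasDerivWithinAt.derivWithin (uniqueDiffOn_Icc hℓ x hx)

/-- A `C¹` function on `[0, ℓ]` whose derivative is a primitive of a function in `L₂`. -/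
theorem IsW22.of_hasDerivAt {ℓ : ℝ} (hℓ : 0 < ℓ) {u u' v : ℝ → ℂ}
    (hu : ∀ x, HasDerivAt u (u' x) x) (hv : MemLp v 2 (volume.restrict (Set.Icc 0 ℓ)))
    (h : ∀ x ∈ Set.Icc 0 ℓ, u' x = u' 0 + ∫ t in (0 : ℝ)..x, v t) : IsW22 ℓ u v := by
  have hd : ∀ x ∈ Set.Icc 0 ℓ, derivWithin u (Set.Icc 0 ℓ) x = u' x := fun x hx =>
    (hu x).hasDerivWithinAt.derivWithin (uniqueDiffOn_Icc hℓ x hx)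
  refine ⟨fun x _ => (hu x).differentiableAt.differentiableWithinAt, hv, fun x hx => ?_⟩
  rw [hd x hx, hd 0 ⟨le_rfl, hℓ.le⟩, h x hx]

theorem ContinuousOn.memLp_Icc {ℓ : ℝ} {v : ℝ → ℂ} (hv : ContinuousOn v (Set.Icc 0 ℓ)) :
    MemLp v 2 (volume.restrict (Set.Icc 0 ℓ)) := by
  obtain ⟨C, hC⟩ := isCompact_Icc.exists_bound_of_continuousOn hv
  refine MemLp.of_bound (hv.aestronglyMeasurable measurableSet_Icc) C ?_
  filter_upwards [ae_restrict_mem measurableSet_Icc] with x hx using hC x hx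

theorem IsW22.of_hasDerivAt_continuous {ℓ : ℝ} (hℓ : 0 < ℓ) {u u' v : ℝ → ℂ}
    (hu : ∀ x, HasDerivAt u (u' x) x) (hu' : ∀ x, HasDerivAt u' (v x) x) (hv : Continuous v) :
    IsW22 ℓ u v := by
  refine .of_hasDerivAt hℓ hu hv.continuousOn.memLp_Icc fun x _ => ?_
  rw [intervalIntegral.integral_eq_sub_of_hasDerivAt (fun t _ => hu' t) (hv.intervalIntegrable _ _)]
  ring

theorem continuous_sol_right (z : ℂ) (p : ℂ × ℂ) : Continuous (sol z p) :=
  continuous_iff_continuousAt.2 fun x => (hasDerivAt_sol z p x).continuousAt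

theorem isW22_sol {ℓ : ℝ} (hℓ : 0 < ℓ) (z : ℂ) (p : ℂ × ℂ) :
    IsW22 ℓ (sol z p) (fun x => -(z * sol z p x)) :=
  .of_hasDerivAt_continuous hℓ (hasDerivAt_sol z p) (hasDerivAt_dsol z p)
    (continuous_const.mul (continuous_sol_right z p)).neg

/-- A solution of `-u'' = z u` on `[0, ℓ]` is determined by its initial data. -/
theorem IsW22.eq_sol {ℓ : ℝ} (hℓ : 0 < ℓ) {z : ℂ} {u : ℝ → ℂ}
    (h : IsW22 ℓ u (fun x => -(z * u x))) {x : ℝ} (hx : x ∈ Set.Icc 0 ℓ) :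
    u x = sol z (u 0, derivWithin u (Set.Icc 0 ℓ) 0) x ∧
      derivWithin u (Set.Icc 0 ℓ) x = dsol z (u 0, derivWithin u (Set.Icc 0 ℓ) 0) x := by
  set I := Set.Icc 0 ℓ with hI
  set u' := derivWithin u I with hu'
  have h1 : ∀ y ∈ I, HasDerivWithinAt u (u' y) I y := fun y hy =>
    (h.differentiableOn y hy).hasDerivWithinAt
  have hc : ContinuousOn u I := h.differentiableOn.continuousOn
  -- The second derivative `-z u` is continuous, so the integral formula for `u'` can be
  -- differentiated at every point.
  have h2 : ∀ y ∈ I, HasDerivWithinAt u' (-(z * u y)) I y := by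
    intro y hy
    have hcv : ContinuousOn (fun x => -(z * u x)) I := (continuousOn_const.mul hc).neg
    have hint : IntervalIntegrable (fun x => -(z * u x)) volume 0 y := by
      refine ContinuousOn.intervalIntegrable ?_
      rw [Set.uIcc_of_le hy.1]
      exact hcv.mono (Set.Icc_subset_Icc_right hy.2)
    have : Fact (y ∈ Set.Icc 0 ℓ) := ⟨hy⟩
    have h3 : HasDerivWithinAt (fun s => ∫ t in (0 : ℝ)..s, -(z * u t)) (-(z * u y)) I y :=
      intervalIntegral.integral_hasDerivWithinAt_right hint
        (hcv.stronglyMeasurableAtFilter_nhdsWithin measurableSet_Icc y) (hcv y hy)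
    exact (h3.const_add (u' 0)).congr (fun s hs => h.deriv_eq s hs) (h.deriv_eq y hy)
  -- Transporting `(u, u')` back to the point `0` gives a constant, which is uniqueness for the
  -- initial value problem.
  have h3 : ∀ y ∈ I, HasDerivWithinAt (fun y => propagator z (-y) (u y, u' y)) 0 I y := by
    intro y hy
    have h4 := ((h1 y hy).prodMk (h2 y hy))
    have h5 := (hasDerivAt_propagator_neg z y).hasDerivWithinAt (s := I)
    have h6 : HasDerivWithinAt (fun y => (propagator z (-y)).restrictScalars ℝ)
        ((-(propagator z (-y) * odeGenerator z)).restrictScalars ℝ) I y :=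
      (ContinuousLinearMap.restrictScalarsL ℂ (ℂ × ℂ) (ℂ × ℂ) ℝ ℝ).hasFDerivAt.comp_hasDerivWithinAt y h5
    have h7 := h6.clm_apply h4
    refine h7.congr_deriv (Eq.symm ?_)
    change (0 : ℂ × ℂ) = -(propagator z (-y) (odeGenerator z (u y, u' y))) +
      propagator z (-y) (u' y, -(z * u y))
    rw [odeGenerator_apply, neg_add_cancel]
  have hconst : propagator z (-x) (u x, u' x) = propagator z (-0) (u 0, u' 0) := by
    refine constant_of_derivWithin_zero (f := fun y => propagator z (-y) (u y, u' y))
      (fun y hy => (h3 y hy).differentiableWithinAt) (fun y hy => ?_) x hx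
    exact (h3 y ⟨hy.1, hy.2.le⟩).derivWithin (uniqueDiffOn_Icc hℓ y ⟨hy.1, hy.2.le⟩)
  have h8 : (u x, u' x) = propagator z x (u 0, u' 0) := by
    rw [← propagator_apply_neg z x (u x, u' x), hconst, neg_zero, propagator_zero]
    rfl
  exact ⟨congrArg Prod.fst h8, congrArg Prod.snd h8⟩

/-- Variation of constants for a continuous right hand side. -/
theorem exists_hasDerivAt_of_continuous (z : ℂ) {g : ℝ → ℂ} (hg : Continuous g) :
    ∃ u u' : ℝ → ℂ, (∀ x, HasDerivAt u (u' x) x) ∧ ∀ x, HasDerivAt u' (-(z * u x) + g x) x := by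
  set G : ℝ → ℂ × ℂ := fun t => propagator z (-t) (0, g t) with hG
  have hGc : Continuous G := by
    have h : Continuous fun t : ℝ => propagator z (-t) :=
      continuous_propagator.comp (f := fun t : ℝ => (z, -t)) (by fun_prop)
    exact h.clm_apply (by fun_prop)
  set m : ℝ → ℂ × ℂ := fun x => ∫ t in (0 : ℝ)..x, G t with hm
  have hm' : ∀ x, HasDerivAt m (G x) x := fun x =>
    hGc.integral_hasStrictDerivAt 0 x |>.hasDerivAt
  have hY : ∀ x, HasDerivAt (fun x => propagator z x (m x))
      (odeGenerator z (propagator z x (m x)) + (0, g x)) x := by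
    intro x
    have h6 : HasDerivAt (fun y => (propagator z y).restrictScalars ℝ)
        ((odeGenerator z * propagator z x).restrictScalars ℝ) x :=
      (ContinuousLinearMap.restrictScalarsL ℂ (ℂ × ℂ) (ℂ × ℂ) ℝ ℝ).hasFDerivAt.comp_hasDerivAt x
        (hasDerivAt_propagator z x)
    have h7 := h6.clm_apply (hm' x)
    refine h7.congr_deriv ?_
    change odeGenerator z (propagator z x (m x)) + propagator z x (propagator z (-x) (0, g x)) = _
    rw [propagator_apply_neg]
  refine ⟨fun x => (propagator z x (m x)).1, fun x => (propagator z x (m x)).2, fun x => ?_,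
    fun x => ?_⟩
  · simpa [odeGenerator_apply] using (hY x).fst_apply
  · simpa [odeGenerator_apply] using (hY x).snd_apply

/-- The equation `-u'' = z u + h` on `[0, ℓ]` has a solution for `h` in `L₂`. -/
theorem exists_isW22 {ℓ : ℝ} (hℓ : 0 < ℓ) (z : ℂ) {h : ℝ → ℂ}
    (hh : MemLp h 2 (volume.restrict (Set.Icc 0 ℓ))) :
    ∃ u, IsW22 ℓ u (fun x => -(z * u x + h x)) := by
  set k : ℝ → ℂ := (Set.Icc 0 ℓ).indicator h with hk
  have hki : Integrable k := by
    rw [hk, integrable_indicator_iff measurableSet_Icc]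
    exact hh.integrable (by norm_num)
  have hkh : k =ᵐ[volume.restrict (Set.Icc 0 ℓ)] h := indicator_ae_eq_restrict measurableSet_Icc
  set H : ℝ → ℂ := fun x => ∫ t in (0 : ℝ)..x, k t with hH
  have hHc : Continuous H := intervalIntegral.continuous_primitive (fun a b => hki.intervalIntegrable) 0
  -- `J'' = h` only almost everywhere. Writing `u = w - J` moves the rough term into `J` and leaves
  -- `w'' = -z w + z J`, whose right hand side is continuous.
  set J : ℝ → ℂ := fun x => ∫ t in (0 : ℝ)..x, H t with hJ
  have hJ' : ∀ x, HasDerivAt J (H x) x := fun x => (hHc.integral_hasStrictDerivAt 0 x).hasDerivAt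
  have hJc : Continuous J := continuous_iff_continuousAt.2 fun x => (hJ' x).continuousAt
  obtain ⟨w, w', hw, hw'⟩ := exists_hasDerivAt_of_continuous z (g := fun x => z * J x) (by fun_prop)
  have hwc : Continuous w := continuous_iff_continuousAt.2 fun x => (hw x).continuousAt
  refine ⟨fun x => w x - J x, ?_⟩
  have hc : Continuous fun t => -(z * w t) + z * J t := by fun_prop
  suffices hs : IsW22 ℓ (fun x => w x - J x) (fun x => -(z * (w x - J x) + k x)) by
    refine hs.congr_ae ?_
    filter_upwards [hkh] with x hx
    rw [hx]
  refine .of_hasDerivAt hℓ (fun x => (hw x).sub (hJ' x)) ?_ fun x hx => ?_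
  · refine MemLp.neg (MemLp.add (Continuous.continuousOn (by fun_prop)).memLp_Icc (hh.ae_eq hkh.symm))
  · have h1 : ∫ t in (0 : ℝ)..x, -(z * (w t - J t) + k t) =
        (∫ t in (0 : ℝ)..x, (-(z * w t) + z * J t)) - ∫ t in (0 : ℝ)..x, k t := by
      rw [← intervalIntegral.integral_sub (hc.intervalIntegrable _ _) hki.intervalIntegrable]
      congr 1
      funext t
      ring
    rw [h1, intervalIntegral.integral_eq_sub_of_hasDerivAt (fun t _ => hw' t)
      (hc.intervalIntegrable _ _)]
    simp only [hH, intervalIntegral.integral_same]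
    ring

/-! ### Symplectic linear algebra. -/

section SymplecticForm

variable (X : Type*) [Fintype X]

/-- The standard symplectic form on `ℂ^X × ℂ^X`. -/
noncomputable def symplecticForm : LinearMap.BilinForm ℂ ((X → ℂ) × (X → ℂ)) :=
  LinearMap.mk₂ ℂ (fun a b => ∑ x, (a.1 x * b.2 x - a.2 x * b.1 x))
    (fun a a' b => by
      rw [← Finset.sum_add_distrib]
      exact Finset.sum_congr rfl fun x _ => by simp only [Prod.fst_add, Prod.snd_add, Pi.add_apply]; ring)
    (fun c a b => by
      rw [Finset.smul_sum]
      exact Finset.sum_congr rfl fun x _ => by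
        simp only [Prod.smul_fst, Prod.smul_snd, Pi.smul_apply, smul_eq_mul]; ring)
    (fun a b b' => by
      rw [← Finset.sum_add_distrib]
      exact Finset.sum_congr rfl fun x _ => by simp only [Prod.fst_add, Prod.snd_add, Pi.add_apply]; ring)
    (fun c a b => by
      rw [Finset.smul_sum]
      exact Finset.sum_congr rfl fun x _ => by
        simp only [Prod.smul_fst, Prod.smul_snd, Pi.smul_apply, smul_eq_mul]; ring)

variable {X}

theorem symplecticForm_apply (a b : (X → ℂ) × (X → ℂ)) :
    symplecticForm X a b = ∑ x, (a.1 x * b.2 x - a.2 x * b.1 x) := rfl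

theorem symplecticForm_swap (a b : (X → ℂ) × (X → ℂ)) :
    symplecticForm X b a = -symplecticForm X a b := by
  simp only [symplecticForm_apply, ← Finset.sum_neg_distrib]
  exact Finset.sum_congr rfl fun x _ => by ring

theorem symplecticForm_isRefl : (symplecticForm X).IsRefl := fun a b h => by
  rw [symplecticForm_swap, h, neg_zero]

theorem symplecticForm_left_injective {a : (X → ℂ) × (X → ℂ)} (h : ∀ b, symplecticForm X a b = 0) :
    a = 0 := by
  classical
  refine Prod.ext (funext fun x => ?_) (funext fun x => ?_)
  · simpa [symplecticForm_apply, Pi.single_apply] using h (0, Pi.single x 1)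
  · simpa [symplecticForm_apply, Pi.single_apply] using h (Pi.single x 1, 0)

theorem symplecticForm_nondegenerate : (symplecticForm X).Nondegenerate :=
  (symplecticForm_isRefl.nondegenerate_iff_separatingLeft).2 fun _ h =>
    symplecticForm_left_injective h

theorem symplecticForm_surjective : Function.Surjective (symplecticForm X) := by
  have hi : Function.Injective (symplecticForm X) := by
    rw [← LinearMap.ker_eq_bot, LinearMap.ker_eq_bot']
    exact fun a ha => symplecticForm_left_injective fun b => by rw [ha]; rfl
  exact (LinearMap.injective_iff_surjective_of_finrank_eq_finrank
    Subspace.dual_finrank_eq.symm).1 hi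

/-- A vector symplectically orthogonal to `W ⊓ K`, where `W` is Lagrangian, lies in the sum of `W` and
the symplectic complement of `K`. -/
theorem exists_sub_orthogonal {W K : Submodule ℂ ((X → ℂ) × (X → ℂ))}
    (hW : ∀ t, (∀ w ∈ W, symplecticForm X t w = 0) → t ∈ W) {t : (X → ℂ) × (X → ℂ)}
    (ht : ∀ w ∈ W ⊓ K, symplecticForm X t w = 0) :
    ∃ w ∈ W, ∀ k ∈ K, symplecticForm X (t - w) k = 0 := by
  have h : symplecticForm X t ∈ (W ⊓ K).dualAnnihilator := by
    rw [Submodule.mem_dualAnnihilator]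
    exact ht
  -- In the dual, the annihilator of an intersection is the sum of the annihilators. Nondegeneracy
  -- turns the summand annihilating `W` into a vector, which lies in `W` because `W` is Lagrangian.
  rw [Subspace.dualAnnihilator_inf_eq, Submodule.mem_sup] at h
  obtain ⟨α, hα, β, hβ, hs⟩ := h
  obtain ⟨a, rfl⟩ := symplecticForm_surjective α
  rw [Submodule.mem_dualAnnihilator] at hα hβ
  refine ⟨a, hW a hα, fun k hk => ?_⟩
  rw [map_sub, ← hs, add_sub_cancel_left]
  exact hβ k hk

end SymplecticForm

/-! ### The Lagrangian space of traces and the Fredholm alternative. -/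

/-- Conservation of the Wronskian. -/
theorem sol_mul_dsol_sub (z : ℂ) (p q : ℂ × ℂ) (x : ℝ) :
    sol z p x * dsol z q x - dsol z p x * sol z q x = p.1 * q.2 - p.2 * q.1 := by
  have h : ∀ y, HasDerivAt (fun y => sol z p y * dsol z q y - dsol z p y * sol z q y) 0 y := fun y =>
    (((hasDerivAt_sol z p y).mul (hasDerivAt_dsol z q y)).sub
      ((hasDerivAt_dsol z p y).mul (hasDerivAt_sol z q y))).congr_deriv (by ring)
  have h' := is_const_of_deriv_eq_zero (fun y => (h y).differentiableAt) (fun y => (h y).deriv) x 0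
  simpa only [sol_zero, dsol_zero] using h'

namespace MetricGraph

section

variable {E V : Type*} (Γ : MetricGraph E V)

/-- The values at the end points of the solution of `-u'' = z u` with initial data `p`. -/
noncomputable def solValue (z : ℂ) : (E → ℂ × ℂ) →ₗ[ℂ] (E × Bool → ℂ) :=
  LinearMap.pi fun x =>
    ((ContinuousLinearMap.fst ℂ ℂ ℂ).comp (propagator z (if x.2 then Γ.length x.1 else 0))).toLinearMap ∘ₗ
      LinearMap.proj x.1

/-- The oriented derivatives at the end points of the solution of `-u'' = z u` with initial
data `p`. -/
noncomputable def solDeriv (z : ℂ) : (E → ℂ × ℂ) →ₗ[ℂ] (E × Bool → ℂ) :=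
  LinearMap.pi fun x => (if x.2 then (-1 : ℂ) else 1) •
    ((ContinuousLinearMap.snd ℂ ℂ ℂ).comp (propagator z (if x.2 then Γ.length x.1 else 0))).toLinearMap ∘ₗ
      LinearMap.proj x.1

theorem solValue_apply (z : ℂ) (p : E → ℂ × ℂ) (x : E × Bool) :
    Γ.solValue z p x = sol z (p x.1) (if x.2 then Γ.length x.1 else 0) := rfl

theorem solDeriv_apply (z : ℂ) (p : E → ℂ × ℂ) (x : E × Bool) :
    Γ.solDeriv z p x = (if x.2 then (-1 : ℂ) else 1) *
      dsol z (p x.1) (if x.2 then Γ.length x.1 else 0) := rfl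

theorem solValue_false (z : ℂ) (p : E → ℂ × ℂ) (e : E) : Γ.solValue z p (e, false) = (p e).1 :=
  sol_zero z (p e)

theorem solValue_true (z : ℂ) (p : E → ℂ × ℂ) (e : E) :
    Γ.solValue z p (e, true) = sol z (p e) (Γ.length e) := rfl

theorem solDeriv_false (z : ℂ) (p : E → ℂ × ℂ) (e : E) : Γ.solDeriv z p (e, false) = (p e).2 := by
  simp [solDeriv_apply, dsol_zero]

theorem solDeriv_true (z : ℂ) (p : E → ℂ × ℂ) (e : E) :
    Γ.solDeriv z p (e, true) = -dsol z (p e) (Γ.length e) := by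
  simp [solDeriv_apply]

theorem endValue_sol (z : ℂ) (p : E → ℂ × ℂ) :
    Γ.endValue (fun e => sol z (p e)) = Γ.solValue z p := rfl

theorem endDeriv_sol (z : ℂ) (p : E → ℂ × ℂ) :
    Γ.endDeriv (fun e => sol z (p e)) = Γ.solDeriv z p := by
  funext ⟨e, s⟩
  have hl := Γ.length_pos e
  cases s
  · simp [endDeriv, solDeriv_apply, derivWithin_sol hl z (p e) ⟨le_rfl, hl.le⟩]
  · simp [endDeriv, solDeriv_apply, derivWithin_sol hl z (p e) ⟨hl.le, le_rfl⟩]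

/-- The values and the oriented derivatives at the end points of solutions. -/
noncomputable def trace (z : ℂ) : (E → ℂ × ℂ) →ₗ[ℂ] (E × Bool → ℂ) × (E × Bool → ℂ) :=
  (Γ.solValue z).prod (Γ.solDeriv z)

theorem trace_injective (z : ℂ) : Function.Injective (Γ.trace z) := by
  intro p q h
  funext e
  have h1 := congrFun (congrArg Prod.fst h) (e, false)
  have h2 := congrFun (congrArg Prod.snd h) (e, false)
  change Γ.solValue z p _ = Γ.solValue z q _ at h1
  change Γ.solDeriv z p _ = Γ.solDeriv z q _ at h2
  rw [solValue_false, solValue_false] at h1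
  rw [solDeriv_false, solDeriv_false] at h2
  exact Prod.ext h1 h2

variable [Fintype E]

/-- On each edge the contributions of the two ends are Wronskians with opposite signs, because the
derivatives point into the edge. -/
theorem symplecticForm_trace (z : ℂ) (p q : E → ℂ × ℂ) :
    symplecticForm (E × Bool) (Γ.trace z p) (Γ.trace z q) = 0 := by
  rw [symplecticForm_apply, Fintype.sum_prod_type]
  refine Finset.sum_eq_zero fun e _ => ?_
  change ∑ s, (Γ.solValue z p (e, s) * Γ.solDeriv z q (e, s) -
    Γ.solDeriv z p (e, s) * Γ.solValue z q (e, s)) = 0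
  rw [Fintype.sum_bool, solValue_false, solValue_false, solDeriv_false, solDeriv_false, solValue_true,
    solValue_true, solDeriv_true, solDeriv_true]
  linear_combination -sol_mul_dsol_sub z (p e) (q e) (Γ.length e)

/-- The range is isotropic of dimension `2|E|` in a space of dimension `4|E|`, hence equal to its
symplectic complement. -/
theorem mem_range_trace (z : ℂ) (t : (E × Bool → ℂ) × (E × Bool → ℂ))
    (ht : ∀ w ∈ LinearMap.range (Γ.trace z), symplecticForm (E × Bool) t w = 0) :
    t ∈ LinearMap.range (Γ.trace z) := by
  set W := LinearMap.range (Γ.trace z) with hW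
  have hle : W ≤ (symplecticForm (E × Bool)).orthogonal W := by
    rintro _ ⟨q, rfl⟩
    rw [LinearMap.BilinForm.mem_orthogonal_iff]
    rintro _ ⟨p, rfl⟩
    exact Γ.symplecticForm_trace z p q
  have hdim : Module.finrank ℂ W = 2 * Fintype.card E := by
    rw [hW, LinearMap.finrank_range_of_inj (Γ.trace_injective z)]
    simp [Module.finrank_pi_fintype, mul_comm]
  have hdim' : Module.finrank ℂ W = Module.finrank ℂ ((symplecticForm (E × Bool)).orthogonal W) := by
    rw [LinearMap.BilinForm.finrank_orthogonal symplecticForm_nondegenerate, hdim]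
    simp
    omega
  rw [Submodule.eq_of_le_of_finrank_eq hle hdim', LinearMap.BilinForm.mem_orthogonal_iff]
  intro w hw
  exact symplecticForm_isRefl _ _ (ht w hw)

open Classical in
/-- The boundary data that are continuous at all vertices, vanish on the vertices in `D`, and satisfy
the Kirchhoff condition at the vertices in `N`. -/
noncomputable def boundarySpace (D N : Set V) : Submodule ℂ ((E × Bool → ℂ) × (E × Bool → ℂ)) where
  carrier := {t | (∀ x y, Γ.vert x = Γ.vert y → t.1 x = t.1 y) ∧ (∀ x, Γ.vert x ∈ D → t.1 x = 0) ∧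
    ∀ v ∈ N, ∑ x : E × Bool with Γ.vert x = v, t.2 x = 0}
  zero_mem' := ⟨fun _ _ _ => rfl, fun _ _ => rfl, fun _ _ => Finset.sum_const_zero⟩
  add_mem' := by
    rintro a b ⟨ha1, ha2, ha3⟩ ⟨hb1, hb2, hb3⟩
    refine ⟨fun x y h => ?_, fun x h => ?_, fun v h => ?_⟩
    · simp [ha1 x y h, hb1 x y h]
    · simp [ha2 x h, hb2 x h]
    · simp [Finset.sum_add_distrib, ha3 v h, hb3 v h]
  smul_mem' := by
    rintro c a ⟨ha1, ha2, ha3⟩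
    refine ⟨fun x y h => ?_, fun x h => ?_, fun v h => ?_⟩
    · simp [ha1 x y h]
    · simp [ha2 x h]
    · simp [← Finset.mul_sum, ha3 v h]

open Classical in
theorem mem_boundarySpace {D N : Set V} {t : (E × Bool → ℂ) × (E × Bool → ℂ)} :
    t ∈ Γ.boundarySpace D N ↔ (∀ x y, Γ.vert x = Γ.vert y → t.1 x = t.1 y) ∧
      (∀ x, Γ.vert x ∈ D → t.1 x = 0) ∧ ∀ v ∈ N, ∑ x : E × Bool with Γ.vert x = v, t.2 x = 0 := Iff.rfl

/-- Taking complements exchanges the two kinds of condition: a vertex without a Kirchhoff condition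
acquires a Dirichlet condition in the adjoint problem, and one without a Dirichlet condition
acquires a Kirchhoff condition. -/
theorem mem_boundarySpace_of_orthogonal {D N : Set V} {t : (E × Bool → ℂ) × (E × Bool → ℂ)}
    (h : ∀ k ∈ Γ.boundarySpace D N, symplecticForm (E × Bool) t k = 0) :
    t ∈ Γ.boundarySpace Nᶜ Dᶜ := by
  classical
  refine Γ.mem_boundarySpace.2 ⟨fun x y hxy => ?_, fun x hx => ?_, fun v hv => ?_⟩
  · have h1 := h (0, Pi.single x 1 - Pi.single y 1)
      (Γ.mem_boundarySpace.2 ⟨fun _ _ _ => rfl, fun _ _ => rfl, fun v _ => by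
        simp [Finset.sum_sub_distrib, hxy]⟩)
    rw [symplecticForm_apply] at h1
    simpa [mul_sub, Finset.sum_sub_distrib, Pi.single_apply, sub_eq_zero] using h1
  · have h1 := h (0, Pi.single x 1)
      (Γ.mem_boundarySpace.2 ⟨fun _ _ _ => rfl, fun _ _ => rfl, fun v hv => by
        have : Γ.vert x ≠ v := fun h => hx (h ▸ hv)
        simp [this]⟩)
    rw [symplecticForm_apply] at h1
    simpa [Pi.single_apply] using h1
  · have h1 := h (fun x => if Γ.vert x = v then 1 else 0, 0)
      (Γ.mem_boundarySpace.2 ⟨fun x y hxy => by simp [hxy], fun x hx => by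
        have : Γ.vert x ≠ v := fun h => hv (h ▸ hx)
        simp [this], fun v _ => by simp⟩)
    rw [symplecticForm_apply] at h1
    simpa [Finset.sum_filter] using h1

/-- The Fredholm alternative for boundary value problems on a metric graph. -/
theorem exists_sub_trace_mem {z : ℂ} {D N : Set V} {t : (E × Bool → ℂ) × (E × Bool → ℂ)}
    (h : ∀ p, Γ.trace z p ∈ Γ.boundarySpace D N → symplecticForm (E × Bool) t (Γ.trace z p) = 0) :
    ∃ p, t - Γ.trace z p ∈ Γ.boundarySpace Nᶜ Dᶜ := by
  obtain ⟨w, ⟨p, rfl⟩, hp⟩ := exists_sub_orthogonal (K := Γ.boundarySpace D N) (Γ.mem_range_trace z)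
    (t := t) (by rintro _ ⟨⟨p, rfl⟩, hp⟩; exact h p hp)
  exact ⟨p, Γ.mem_boundarySpace_of_orthogonal hp⟩

end

end MetricGraph

/-! ### Green's identities and norms of solutions. -/

/-- Green's identity on an interval for two spectral parameters. -/
theorem sol_green (z w : ℂ) (p q : ℂ × ℂ) (ℓ : ℝ) :
    (sol z p ℓ * star (dsol w q ℓ) - dsol z p ℓ * star (sol w q ℓ)) -
      (p.1 * star q.2 - p.2 * star q.1) =
      (z - star w) * ∫ x in (0 : ℝ)..ℓ, sol z p x * star (sol w q x) := by
  have h : ∀ y, HasDerivAt (fun y => sol z p y * star (dsol w q y) - dsol z p y * star (sol w q y))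
      ((z - star w) * (sol z p y * star (sol w q y))) y := fun y =>
    (((hasDerivAt_sol z p y).mul (hasDerivAt_dsol w q y).star).sub
      ((hasDerivAt_dsol z p y).mul (hasDerivAt_sol w q y).star)).congr_deriv (by
        simp only [star_neg, star_mul']
        ring)
  have hc : Continuous fun y => (z - star w) * (sol z p y * star (sol w q y)) :=
    continuous_const.mul ((continuous_sol_right z p).mul (continuous_sol_right w q).star)
  rw [← intervalIntegral.integral_const_mul, intervalIntegral.integral_eq_sub_of_hasDerivAt
    (fun y _ => h y) (hc.intervalIntegrable _ _)]
  simp only [sol_zero, dsol_zero]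

namespace MetricGraph

section Norm

variable {E V : Type*} [Fintype E] (Γ : MetricGraph E V)

/-- The inner product in `L₂(Γ)` of the solutions of `-u'' = z u` and `-v'' = w v` with initial
data `p` and `q`. -/
noncomputable def solInner (z w : ℂ) (p q : E → ℂ × ℂ) : ℂ :=
  ∑ e, ∫ x in (0 : ℝ)..Γ.length e, sol z (p e) x * star (sol w (q e) x)

/-- The squared norm in `L₂(Γ)` of the solution of `-u'' = z u` with initial data `p`. -/
noncomputable def solNormSq (z : ℂ) (p : E → ℂ × ℂ) : ℝ :=
  ∑ e, ∫ x in (0 : ℝ)..Γ.length e, ‖sol z (p e) x‖ ^ 2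

theorem sum_green (z w : ℂ) (p q : E → ℂ × ℂ) :
    ∑ x, (star (Γ.solValue w q x) * Γ.solDeriv z p x - star (Γ.solDeriv w q x) * Γ.solValue z p x) =
      (z - star w) * Γ.solInner z w p q := by
  rw [solInner, Finset.mul_sum, Fintype.sum_prod_type]
  refine Finset.sum_congr rfl fun e _ => ?_
  rw [Fintype.sum_bool, solValue_false, solValue_false, solDeriv_false, solDeriv_false, solValue_true,
    solValue_true, solDeriv_true, solDeriv_true, ← sol_green, star_neg]
  ring

theorem solInner_self (z : ℂ) (p : E → ℂ × ℂ) : Γ.solInner z z p p = Γ.solNormSq z p := by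
  rw [solInner, solNormSq, Complex.ofReal_sum]
  refine Finset.sum_congr rfl fun e _ => ?_
  rw [← intervalIntegral.integral_ofReal]
  congr 1
  funext x
  rw [Complex.ofReal_pow]
  exact Complex.mul_conj' _

theorem re_solInner_le (z w : ℂ) (p q : E → ℂ × ℂ) :
    (Γ.solInner z w p q).re ≤ (Γ.solNormSq z p + Γ.solNormSq w q) / 2 := by
  rw [solInner, solNormSq, solNormSq, Complex.re_sum, ← Finset.sum_add_distrib, Finset.sum_div]
  refine Finset.sum_le_sum fun e _ => ?_
  have h1 := continuous_sol_right z (p e)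
  have h2 := continuous_sol_right w (q e)
  have hc : Continuous fun x => sol z (p e) x * star (sol w (q e) x) := h1.mul h2.star
  have hre : (∫ x in (0 : ℝ)..Γ.length e, sol z (p e) x * star (sol w (q e) x)).re =
      ∫ x in (0 : ℝ)..Γ.length e, (sol z (p e) x * star (sol w (q e) x)).re :=
    (Complex.reCLM.intervalIntegral_comp_comm (hc.intervalIntegrable _ _)).symm
  have h1' : Continuous fun x => ‖sol z (p e) x‖ ^ 2 := h1.norm.pow 2
  have h2' : Continuous fun x => ‖sol w (q e) x‖ ^ 2 := h2.norm.pow 2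
  rw [hre, ← intervalIntegral.integral_add (h1'.intervalIntegrable _ _)
    (h2'.intervalIntegrable _ _), ← intervalIntegral.integral_div]
  refine intervalIntegral.integral_mono_on (Γ.length_pos e).le
    ((Complex.continuous_re.comp hc).intervalIntegrable _ _)
    (((h1'.add h2').div_const 2).intervalIntegrable _ _) fun x _ => ?_
  have h3 := Complex.re_le_norm (sol z (p e) x * star (sol w (q e) x))
  rw [norm_mul, norm_star] at h3
  nlinarith [sq_nonneg (‖sol z (p e) x‖ - ‖sol w (q e) x‖)]

theorem continuous_solNormSq : Continuous fun q : ℂ × (E → ℂ × ℂ) => Γ.solNormSq q.1 q.2 := by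
  unfold solNormSq
  refine continuous_finsetSum _ fun e _ => ?_
  refine intervalIntegral.continuous_parametric_intervalIntegral_of_continuous'
    (f := fun (q : ℂ × (E → ℂ × ℂ)) x => ‖sol q.1 (q.2 e) x‖ ^ 2) ?_ 0 (Γ.length e)
  have h : Continuous fun r : (ℂ × (E → ℂ × ℂ)) × ℝ => sol r.1.1 (r.1.2 e) r.2 :=
    continuous_sol.comp (f := fun r : (ℂ × (E → ℂ × ℂ)) × ℝ => ((r.1.1, r.1.2 e), r.2)) (by fun_prop)
  exact h.norm.pow 2

theorem solNormSq_nonneg (z : ℂ) (p : E → ℂ × ℂ) : 0 ≤ Γ.solNormSq z p :=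
  Finset.sum_nonneg fun e _ => intervalIntegral.integral_nonneg (Γ.length_pos e).le
    fun _ _ => by positivity

theorem _root_.sol_eq_zero {ℓ : ℝ} (hℓ : 0 < ℓ) {z : ℂ} {p : ℂ × ℂ}
    (h : ∀ x ∈ Set.Icc 0 ℓ, sol z p x = 0) : p = 0 := by
  have h0 : (0 : ℝ) ∈ Set.Icc 0 ℓ := ⟨le_rfl, hℓ.le⟩
  have h1 : p.1 = 0 := by rw [← sol_zero z p, h 0 h0]
  have h2 : p.2 = 0 := by
    rw [← dsol_zero z p, ← derivWithin_sol hℓ z p h0,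
      derivWithin_congr (f := fun _ => (0 : ℂ)) (fun x hx => h x hx) (h 0 h0)]
    simp
  exact Prod.ext h1 h2

theorem eq_zero_of_solNormSq {z : ℂ} {p : E → ℂ × ℂ} (h : Γ.solNormSq z p = 0) : p = 0 := by
  have h1 := (Finset.sum_eq_zero_iff_of_nonneg fun e _ =>
    intervalIntegral.integral_nonneg (Γ.length_pos e).le fun _ _ => by positivity).1 h
  funext e
  have h2 := h1 e (Finset.mem_univ e)
  have hc : Continuous fun x => ‖sol z (p e) x‖ ^ 2 := (continuous_sol_right z (p e)).norm.pow 2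
  refine sol_eq_zero (Γ.length_pos e) (z := z) fun x hx => ?_
  by_contra hne
  have h3 := intervalIntegral.integral_pos (Γ.length_pos e) hc.continuousOn
    (fun _ _ => by positivity) ⟨x, hx, by positivity⟩
  exact h3.ne' h2

theorem sol_smul (z c : ℂ) (p : ℂ × ℂ) (x : ℝ) : sol z (c • p) x = c * sol z p x := by
  simp [sol]

theorem solNormSq_smul (z : ℂ) (c : ℝ) (p : E → ℂ × ℂ) :
    Γ.solNormSq z ((c : ℂ) • p) = c ^ 2 * Γ.solNormSq z p := by
  rw [solNormSq, solNormSq, Finset.mul_sum]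
  refine Finset.sum_congr rfl fun e _ => ?_
  rw [← intervalIntegral.integral_const_mul]
  congr 1
  funext x
  rw [Pi.smul_apply, sol_smul, norm_mul, mul_pow, Complex.norm_real, Real.norm_eq_abs, sq_abs]

/-- The initial data of a solution are bounded by its norm in `L₂(Γ)`, locally uniformly in the
spectral parameter. -/
theorem exists_le_solNormSq (z₀ : ℂ) :
    ∃ m > 0, ∀ z ∈ Metric.closedBall z₀ 1, ∀ p : E → ℂ × ℂ, m * ‖p‖ ^ 2 ≤ Γ.solNormSq z p := by
  -- The squared norm is continuous and positive on this compact set, hence bounded below there;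
  -- homogeneity gives all `p`.
  have hk : IsCompact (Metric.closedBall z₀ 1 ×ˢ Metric.sphere (0 : E → ℂ × ℂ) 1) :=
    (isCompact_closedBall z₀ 1).prod (isCompact_sphere 0 1)
  obtain ⟨m, hm, h⟩ := hk.exists_forall_le' Γ.continuous_solNormSq.continuousOn (a := 0) (by
    rintro ⟨z, p⟩ ⟨-, hp⟩
    refine lt_of_le_of_ne (Γ.solNormSq_nonneg z p) fun h0 => ?_
    rw [Γ.eq_zero_of_solNormSq h0.symm] at hp
    simp at hp)
  refine ⟨m, hm, fun z hz p => ?_⟩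
  rcases eq_or_ne p 0 with rfl | hp
  · simpa using Γ.solNormSq_nonneg z 0
  · have hn : 0 < ‖p‖ := norm_pos_iff.2 hp
    have h1 := h (z, ((‖p‖⁻¹ : ℝ) : ℂ) • p) ⟨hz, by simp [norm_smul, hn.ne']⟩
    rw [solNormSq_smul, inv_pow, inv_mul_eq_div, le_div_iff₀ (by positivity)] at h1
    exact h1

end Norm

/-! ### Boundary data at the contact vertices. -/

section Contact

variable {E V B : Type*} [Fintype E] (Γ : MetricGraph E V) (c : B ↪ V)

/-- The initial data of the solutions of `-u'' = z u` that are continuous at all vertices, vanish on `D`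
and satisfy the Kirchhoff condition on `N`. -/
noncomputable def solSpace (D N : Set V) (z : ℂ) : Submodule ℂ (E → ℂ × ℂ) :=
  (Γ.boundarySpace D N).comap (Γ.trace z)

open Classical in
theorem mem_solSpace {D N : Set V} {z : ℂ} {p : E → ℂ × ℂ} :
    p ∈ Γ.solSpace D N z ↔ (∀ x y, Γ.vert x = Γ.vert y → Γ.solValue z p x = Γ.solValue z p y) ∧
      (∀ x, Γ.vert x ∈ D → Γ.solValue z p x = 0) ∧
      ∀ v ∈ N, ∑ x : E × Bool with Γ.vert x = v, Γ.solDeriv z p x = 0 := Iff.rfl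

open Classical in
/-- The boundary values and the boundary derivatives of a solution at the contact vertices. -/
noncomputable def contactData (z : ℂ) : (E → ℂ × ℂ) →ₗ[ℂ] (B → ℂ) × (B → ℂ) :=
  (LinearMap.pi fun b => LinearMap.proj (Function.surjInv Γ.vert_surjective (c b)) ∘ₗ Γ.solValue z).prod
    (LinearMap.pi fun b => ∑ x : E × Bool with Γ.vert x = c b, LinearMap.proj x ∘ₗ Γ.solDeriv z)

open Classical in
theorem contactData_snd (z : ℂ) (p : E → ℂ × ℂ) (b : B) :
    (Γ.contactData c z p).2 b = ∑ x : E × Bool with Γ.vert x = c b, Γ.solDeriv z p x := by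
  simp [contactData]

variable {Γ c}

theorem contactData_fst {D N : Set V} {z : ℂ} {p : E → ℂ × ℂ} (hp : p ∈ Γ.solSpace D N z)
    {x : E × Bool} {b : B} (hx : Γ.vert x = c b) :
    (Γ.contactData c z p).1 b = Γ.solValue z p x :=
  (Γ.mem_solSpace.1 hp).1 _ _ ((Function.surjInv_eq _ _).trans hx.symm)

variable (Γ c)

-- Summing over the ends vertex by vertex, only contact vertices contribute. This reduces sums over
-- all ends to boundary data.
open Classical in
theorem sum_vert_mul [Fintype V] [Fintype B] {ψ : E × Bool → ℂ}
    (hψ : ∀ v ∈ (Set.range c)ᶜ, ∑ x : E × Bool with Γ.vert x = v, ψ x = 0) (H : V → ℂ) :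
    ∑ x, H (Γ.vert x) * ψ x = ∑ b, H (c b) * ∑ x : E × Bool with Γ.vert x = c b, ψ x := by
  have h1 : ∑ x, H (Γ.vert x) * ψ x = ∑ v, H v * ∑ x : E × Bool with Γ.vert x = v, ψ x := by
    rw [← Finset.sum_fiberwise Finset.univ Γ.vert]
    refine Finset.sum_congr rfl fun v _ => ?_
    rw [Finset.mul_sum]
    refine Finset.sum_congr rfl fun x hx => ?_
    rw [(Finset.mem_filter.1 hx).2]
  rw [h1, ← Finset.sum_map Finset.univ c
    (fun v => H v * ∑ x : E × Bool with Γ.vert x = v, ψ x)]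
  refine (Finset.sum_subset (Finset.subset_univ _) fun v _ hv => ?_).symm
  rw [hψ v fun ⟨b, hb⟩ => hv (Finset.mem_map.2 ⟨b, Finset.mem_univ b, hb⟩), mul_zero]

variable {Γ c}

theorem sum_vert_mul_solDeriv [Fintype V] [Fintype B] {D : Set V} {z : ℂ} {p : E → ℂ × ℂ}
    (hp : p ∈ Γ.solSpace D (Set.range c)ᶜ z) (H : V → ℂ) :
    ∑ x, H (Γ.vert x) * Γ.solDeriv z p x = ∑ b, H (c b) * (Γ.contactData c z p).2 b := by
  simp only [contactData_snd]
  exact Γ.sum_vert_mul c (Γ.mem_solSpace.1 hp).2.2 H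

theorem exists_potential {D N : Set V} {z : ℂ} {p : E → ℂ × ℂ} (hp : p ∈ Γ.solSpace D N z) :
    ∃ F : V → ℂ, (∀ x, Γ.solValue z p x = F (Γ.vert x)) ∧
      ∀ b, (Γ.contactData c z p).1 b = F (c b) :=
  ⟨fun v => Γ.solValue z p (Function.surjInv Γ.vert_surjective v),
    fun _ => (Γ.mem_solSpace.1 hp).1 _ _ (Function.surjInv_eq _ _).symm, fun _ => rfl⟩

/-- Green's identity for two solutions with the same spectral parameter. -/
theorem sum_contactData [Fintype V] [Fintype B] {z : ℂ} {p q : E → ℂ × ℂ}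
    (hp : p ∈ Γ.solSpace ∅ (Set.range c)ᶜ z) (hq : q ∈ Γ.solSpace ∅ (Set.range c)ᶜ z) :
    symplecticForm B (Γ.contactData c z p) (Γ.contactData c z q) = 0 := by
  obtain ⟨F, hF, hF'⟩ := exists_potential (c := c) hp
  obtain ⟨G, hG, hG'⟩ := exists_potential (c := c) hq
  have h1 := Γ.symplecticForm_trace z p q
  have h2 := sum_vert_mul_solDeriv hp G
  have h3 := sum_vert_mul_solDeriv hq F
  have h4 : symplecticForm (E × Bool) (Γ.trace z p) (Γ.trace z q) =
      ∑ x, F (Γ.vert x) * Γ.solDeriv z q x - ∑ x, G (Γ.vert x) * Γ.solDeriv z p x := by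
    rw [symplecticForm_apply, ← Finset.sum_sub_distrib]
    refine Finset.sum_congr rfl fun x _ => ?_
    rw [← hF x, ← hG x, mul_comm (Γ.solValue z q x)]
    rfl
  rw [h4, h2, h3, ← Finset.sum_sub_distrib] at h1
  rw [symplecticForm_apply, ← h1]
  refine Finset.sum_congr rfl fun b _ => ?_
  rw [hF' b, hG' b]
  ring

/-- Green's identity for two solutions with different spectral parameters. -/
theorem sum_star_contactData [Fintype V] [Fintype B] {z w : ℂ} {p q : E → ℂ × ℂ}
    (hp : p ∈ Γ.solSpace ∅ (Set.range c)ᶜ z) (hq : q ∈ Γ.solSpace ∅ (Set.range c)ᶜ w) :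
    ∑ b, (star ((Γ.contactData c w q).1 b) * (Γ.contactData c z p).2 b -
      star ((Γ.contactData c w q).2 b) * (Γ.contactData c z p).1 b) =
      (z - star w) * Γ.solInner z w p q := by
  obtain ⟨F, hF, hF'⟩ := exists_potential (c := c) hp
  obtain ⟨G, hG, hG'⟩ := exists_potential (c := c) hq
  have h2 := sum_vert_mul_solDeriv hp (fun v => star (G v))
  have h3 := congrArg star (sum_vert_mul_solDeriv hq (fun v => star (F v)))
  simp only [star_sum, star_mul', star_star] at h3
  rw [← sum_green, Finset.sum_sub_distrib, Finset.sum_sub_distrib]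
  simp only [hF, hG, hF', hG']
  rw [h2]
  simp only [mul_comm (star _) (F _)]
  rw [h3]

theorem solSpace_mono_left {D N : Set V} {z : ℂ} : Γ.solSpace D N z ≤ Γ.solSpace ∅ N z :=
  fun _ hp => ⟨hp.1, fun _ h => h.elim, hp.2.2⟩

/-- For a non-real spectral parameter a solution is determined by its boundary values. -/
theorem eq_zero_of_contactData_fst [Fintype V] [Fintype B] {z : ℂ} (hz : z.im ≠ 0) {p : E → ℂ × ℂ}
    (hp : p ∈ Γ.solSpace ∅ (Set.range c)ᶜ z) (h : (Γ.contactData c z p).1 = 0) : p = 0 := by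
  have h1 := sum_star_contactData hp hp
  rw [solInner_self, h] at h1
  simp only [Pi.zero_apply, star_zero, zero_mul, mul_zero, sub_zero, Finset.sum_const_zero] at h1
  rcases mul_eq_zero.1 h1.symm with h2 | h2
  · exact (hz (Complex.conj_eq_iff_im.1 (sub_eq_zero.1 h2).symm)).elim
  · exact Γ.eq_zero_of_solNormSq (Complex.ofReal_eq_zero.1 h2)

/-- For a non-real spectral parameter there is a solution with given boundary values. -/
theorem exists_contactData_fst [Fintype V] [Fintype B] {z : ℂ} (hz : z.im ≠ 0) (f : B → ℂ) :
    ∃ p ∈ Γ.solSpace ∅ (Set.range c)ᶜ z, (Γ.contactData c z p).1 = f := by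
  -- These conditions are self-adjoint, and for non-real `z` the homogeneous problem has only the
  -- zero solution, so every right hand side is admissible.
  obtain ⟨p, hp⟩ := Γ.exists_sub_trace_mem (z := z) (D := Set.range c) (N := (Set.range c)ᶜ)
    (t := (fun x => Function.extend c f 0 (Γ.vert x), 0)) (by
      intro p hp
      have hp' : p ∈ Γ.solSpace (Set.range c) (Set.range c)ᶜ z := hp
      rw [eq_zero_of_contactData_fst (c := c) hz (solSpace_mono_left hp')
        (funext fun b => (contactData_fst hp' (Function.surjInv_eq Γ.vert_surjective (c b))).trans
          (hp'.2.1 _ ⟨b, (Function.surjInv_eq Γ.vert_surjective (c b)).symm⟩)), map_zero, map_zero])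
  obtain ⟨h1, h2, h3⟩ := Γ.mem_boundarySpace.1 hp
  have hS : p ∈ Γ.solSpace ∅ (Set.range c)ᶜ z := by
    refine Γ.mem_solSpace.2 ⟨fun x y hxy => ?_, fun _ h => h.elim, fun v hv => ?_⟩
    · have h4 := h1 x y hxy
      change Function.extend c f 0 (Γ.vert x) - Γ.solValue z p x =
        Function.extend c f 0 (Γ.vert y) - Γ.solValue z p y at h4
      rw [hxy] at h4
      exact sub_right_injective h4
    · have h4 := h3 v hv
      rw [← neg_eq_zero, ← Finset.sum_neg_distrib]
      exact Eq.trans (Finset.sum_congr rfl fun x _ => (zero_sub _).symm) h4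
  refine ⟨p, hS, funext fun b => ?_⟩
  have hx := Function.surjInv_eq Γ.vert_surjective (c b)
  rw [contactData_fst hS hx]
  have h4 := h2 _ (by rw [compl_compl]; exact ⟨b, hx.symm⟩)
  change Function.extend c f 0 (Γ.vert _) - Γ.solValue z p _ = 0 at h4
  rw [hx, c.injective.extend_apply] at h4
  exact (sub_eq_zero.1 h4).symm

/-- The pairs of boundary values and derivatives of solutions form a maximal isotropic space. -/
theorem exists_contactData_eq [Fintype V] [Fintype B] {z : ℂ} {d : (B → ℂ) × (B → ℂ)}
    (h : ∀ p ∈ Γ.solSpace ∅ (Set.range c)ᶜ z, symplecticForm B d (Γ.contactData c z p) = 0) :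
    ∃ p ∈ Γ.solSpace ∅ (Set.range c)ᶜ z, Γ.contactData c z p = d := by
  classical
  -- The prescribed sum of derivatives at a vertex is placed on one chosen end of that vertex.
  set ψ : E × Bool → ℂ := fun x =>
    if x = Function.surjInv Γ.vert_surjective (Γ.vert x) then Function.extend c d.2 0 (Γ.vert x) else 0
    with hψ
  have hψs : ∀ v, ∑ x : E × Bool with Γ.vert x = v, ψ x = Function.extend c d.2 0 v := by
    intro v
    have hx := Function.surjInv_eq Γ.vert_surjective v
    rw [Finset.sum_eq_single (Function.surjInv Γ.vert_surjective v)]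
    · simp [hψ, hx]
    · intro y hy hne
      rw [(Finset.mem_filter.1 hy).2.symm] at hne
      simp [hψ, hne]
    · intro hn
      exact (hn (Finset.mem_filter.2 ⟨Finset.mem_univ _, hx⟩)).elim
  have hψ0 : ∀ v ∈ (Set.range c)ᶜ, ∑ x : E × Bool with Γ.vert x = v, ψ x = 0 := fun v hv => by
    rw [hψs v, Function.extend_apply' _ _ _ hv]
    rfl
  -- Here the solvability condition, after summation by vertices, is exactly orthogonality of `d` to
  -- the boundary data of all solutions.
  obtain ⟨p, hp⟩ := Γ.exists_sub_trace_mem (z := z) (D := ∅) (N := (Set.range c)ᶜ)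
    (t := (fun x => Function.extend c d.1 0 (Γ.vert x), ψ)) (by
      intro p hp
      have hp' : p ∈ Γ.solSpace ∅ (Set.range c)ᶜ z := hp
      obtain ⟨F, hF, hF'⟩ := exists_potential (c := c) hp'
      have h1 := sum_vert_mul_solDeriv hp' (Function.extend c d.1 0)
      have h2 := Γ.sum_vert_mul c hψ0 F
      rw [← h p hp', symplecticForm_apply, symplecticForm_apply, Finset.sum_sub_distrib,
        Finset.sum_sub_distrib]
      congr 1
      · refine h1.trans (Finset.sum_congr rfl fun b _ => ?_)
        rw [c.injective.extend_apply]
      · refine Eq.trans (Finset.sum_congr rfl fun x _ => ?_) (h2.trans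
          (Finset.sum_congr rfl fun b _ => ?_))
        · rw [mul_comm, ← hF x]
          rfl
        · rw [hψs, c.injective.extend_apply, hF', mul_comm])
  obtain ⟨h1, h2, h3⟩ := Γ.mem_boundarySpace.1 hp
  have hsum : ∀ v, ∑ x : E × Bool with Γ.vert x = v, Γ.solDeriv z p x = Function.extend c d.2 0 v := by
    intro v
    have h4 := h3 v (by simp)
    change ∑ x with _, (ψ x - Γ.solDeriv z p x) = 0 at h4
    rw [Finset.sum_sub_distrib, hψs v, sub_eq_zero] at h4
    exact h4.symm
  have hS : p ∈ Γ.solSpace ∅ (Set.range c)ᶜ z := by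
    refine Γ.mem_solSpace.2 ⟨fun x y hxy => ?_, fun _ h => h.elim, fun v hv => ?_⟩
    · have h4 := h1 x y hxy
      change Function.extend c d.1 0 (Γ.vert x) - Γ.solValue z p x =
        Function.extend c d.1 0 (Γ.vert y) - Γ.solValue z p y at h4
      rw [hxy] at h4
      exact sub_right_injective h4
    · exact (hsum v).trans (by rw [Function.extend_apply' _ _ _ hv]; rfl)
  refine ⟨p, hS, Prod.ext (funext fun b => ?_) (funext fun b => ?_)⟩
  · have hx := Function.surjInv_eq Γ.vert_surjective (c b)
    rw [contactData_fst hS hx]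
    have h4 := h2 _ (by rw [compl_compl]; exact ⟨b, hx.symm⟩)
    change Function.extend c d.1 0 (Γ.vert _) - Γ.solValue z p _ = 0 at h4
    rw [hx, c.injective.extend_apply] at h4
    exact (sub_eq_zero.1 h4).symm
  · rw [contactData_snd]
    exact (hsum (c b)).trans (c.injective.extend_apply _ _ _)

end Contact

end MetricGraph

/-! ### From non-real to real spectral parameters. -/

namespace MetricGraph

open Filter Topology

section Limit

variable {E V B : Type*} {Γ : MetricGraph E V} {c : B ↪ V}

theorem continuous_solValue (x : E × Bool) :
    Continuous fun q : ℂ × (E → ℂ × ℂ) => Γ.solValue q.1 q.2 x :=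
  continuous_sol.comp (f := fun q : ℂ × (E → ℂ × ℂ) =>
    ((q.1, q.2 x.1), (if x.2 then Γ.length x.1 else 0 : ℝ))) (by fun_prop)

theorem continuous_solDeriv (x : E × Bool) :
    Continuous fun q : ℂ × (E → ℂ × ℂ) => Γ.solDeriv q.1 q.2 x :=
  continuous_const.mul (continuous_dsol.comp (f := fun q : ℂ × (E → ℂ × ℂ) =>
    ((q.1, q.2 x.1), (if x.2 then Γ.length x.1 else 0 : ℝ))) (by fun_prop))

variable [Fintype E]

theorem continuous_contactData :
    Continuous fun q : ℂ × (E → ℂ × ℂ) => Γ.contactData c q.1 q.2 := by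
  classical
  refine .prodMk (continuous_pi fun b => continuous_solValue _) (continuous_pi fun b => ?_)
  have h : (fun q : ℂ × (E → ℂ × ℂ) => (Γ.contactData c q.1 q.2).2 b) = fun q =>
      ∑ x : E × Bool with Γ.vert x = c b, Γ.solDeriv q.1 q.2 x := by
    funext q
    convert Γ.contactData_snd c q.1 q.2 b
  change Continuous fun q : ℂ × (E → ℂ × ℂ) => (Γ.contactData c q.1 q.2).2 b
  rw [h]
  exact continuous_finsetSum _ fun x _ => continuous_solDeriv x

theorem isClosed_solSpace (D N : Set V) :
    IsClosed {q : ℂ × (E → ℂ × ℂ) | q.2 ∈ Γ.solSpace D N q.1} := by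
  classical
  simp only [mem_solSpace, Set.ofPred_and, Set.ofPred_forall]
  refine .inter ?_ (.inter ?_ ?_)
  · exact isClosed_iInter fun x => isClosed_iInter fun y => isClosed_iInter fun _ =>
      isClosed_eq (continuous_solValue x) (continuous_solValue y)
  · exact isClosed_iInter fun x => isClosed_iInter fun _ =>
      isClosed_eq (continuous_solValue x) continuous_const
  · exact isClosed_iInter fun x => isClosed_iInter fun _ =>
      isClosed_eq (continuous_finsetSum _ fun x _ => continuous_solDeriv x) continuous_const

theorem tendsto_contactData {α : Type*} {l : Filter α} {z : α → ℂ} {p : α → E → ℂ × ℂ} {z₀ : ℂ}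
    {p₀ : E → ℂ × ℂ} (hz : Tendsto z l (𝓝 z₀)) (hp : Tendsto p l (𝓝 p₀)) :
    Tendsto (fun n => Γ.contactData c (z n) (p n)) l (𝓝 (Γ.contactData c z₀ p₀)) := by
  have h : Tendsto (fun q : ℂ × (E → ℂ × ℂ) => Γ.contactData c q.1 q.2) (𝓝 (z₀, p₀))
    (𝓝 (Γ.contactData c z₀ p₀)) := continuous_contactData.tendsto (z₀, p₀)
  generalize Γ.contactData c = F at h ⊢
  exact h.comp (hz.prodMk_nhds hp)

theorem mem_solSpace_of_tendsto {α : Type*} {l : Filter α} [l.NeBot] {D N : Set V} {z : α → ℂ}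
    {p : α → E → ℂ × ℂ} {z₀ : ℂ} {p₀ : E → ℂ × ℂ} (hz : Tendsto z l (𝓝 z₀))
    (hp : Tendsto p l (𝓝 p₀)) (h : ∀ n, p n ∈ Γ.solSpace D N (z n)) : p₀ ∈ Γ.solSpace D N z₀ := by
  have hc := isClosed_solSpace (Γ := Γ) D N
  generalize Γ.solSpace D N = S at hc h ⊢
  exact hc.mem_of_tendsto (hz.prodMk_nhds hp) (.of_forall h)

variable [Fintype V] [Fintype B]

/-- Let `u` and `v` be the solutions given by `q` and `p`, and `f` their common contact values. The
imaginary part of `∑ star f * ∂u` equals `ε ‖u‖²` by Green's identity for `u, u`. By the identity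
for `u, v` it equals `ε Re ⟨u, v⟩`, since `∑ star f * ∂v` is real by the identity for `v, v`. Hence
`‖u‖² = Re ⟨u, v⟩ ≤ (‖u‖² + ‖v‖²) / 2`. -/
theorem solNormSq_le_of_contactData_fst_eq {z₀ : ℂ} (hz₀ : z₀.im = 0) {ε : ℝ} (hε : 0 < ε)
    {p q : E → ℂ × ℂ} (hp : p ∈ Γ.solSpace ∅ (Set.range c)ᶜ z₀)
    (hq : q ∈ Γ.solSpace ∅ (Set.range c)ᶜ (z₀ + ε * Complex.I))
    (h : (Γ.contactData c (z₀ + ε * Complex.I) q).1 = (Γ.contactData c z₀ p).1) :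
    Γ.solNormSq (z₀ + ε * Complex.I) q ≤ Γ.solNormSq z₀ p := by
  set z := z₀ + ε * Complex.I with hz
  have hs : star z₀ = z₀ := Complex.conj_eq_iff_im.2 hz₀
  have hzs : z - star z = 2 * ε * Complex.I := by
    have : star z = z₀ - ε * Complex.I := by
      rw [hz, star_add, hs, star_mul']
      simp [sub_eq_add_neg]
    rw [this, hz]
    ring
  have h1 := sum_star_contactData hq hq
  have h2 := sum_star_contactData hq hp
  have h3 := sum_star_contactData hp hp
  rw [solInner_self, hzs, h, Finset.sum_sub_distrib] at h1
  rw [hs, h, Finset.sum_sub_distrib] at h2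
  rw [hs, sub_self, zero_mul, Finset.sum_sub_distrib] at h3
  set f := (Γ.contactData c z₀ p).1
  set a : ℂ := ∑ b, star (f b) * (Γ.contactData c z q).2 b with ha
  set a' : ℂ := ∑ b, star (f b) * (Γ.contactData c z₀ p).2 b with ha'
  have hsa : ∑ b, star ((Γ.contactData c z q).2 b) * f b = star a := by
    simp [ha, mul_comm]
  have hsa' : ∑ b, star ((Γ.contactData c z₀ p).2 b) * f b = star a' := by
    simp [ha', mul_comm]
  rw [hsa] at h1
  rw [hsa'] at h2 h3
  have i1 := congrArg Complex.im h1
  have i2 := congrArg Complex.im h2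
  have i3 := congrArg Complex.im h3
  have hzz : z - z₀ = ε * Complex.I := by rw [hz]; ring
  rw [hzz] at i2
  have e1 : (star a).im = -a.im := Complex.conj_im a
  have e2 : (star a').im = -a'.im := Complex.conj_im a'
  simp only [Complex.sub_im, e1, e2, Complex.mul_im, Complex.mul_re, Complex.I_re, Complex.I_im,
    Complex.ofReal_re, Complex.ofReal_im, Complex.re_ofNat, Complex.im_ofNat, Complex.zero_im] at i1 i2 i3
  ring_nf at i1 i2 i3
  have h4 := Γ.re_solInner_le z z₀ q p
  have h5 : ε * Γ.solNormSq z q = ε * (Γ.solInner z z₀ q p).re := by linarith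
  have h6 := mul_left_cancel₀ hε.ne' h5
  linarith

end Limit

section Transfer

variable {E₁ V₁ E₂ V₂ B : Type*} [Fintype E₁] [Fintype E₂] [Fintype V₁] [Fintype V₂] [Fintype B]
  {R₁ : MetricGraph E₁ V₁} {R₂ : MetricGraph E₂ V₂} {c₁ : B ↪ V₁} {c₂ : B ↪ V₂}

/-- By Green's identity the boundary data determine `2i Im z` times the squared norm. This carries
the bound on one subgraph over to the other. -/
theorem solNormSq_eq_of_contactData_eq {z : ℂ} (hz : z.im ≠ 0) {p : E₁ → ℂ × ℂ} {q : E₂ → ℂ × ℂ}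
    (hp : p ∈ R₁.solSpace ∅ (Set.range c₁)ᶜ z) (hq : q ∈ R₂.solSpace ∅ (Set.range c₂)ᶜ z)
    (h : R₂.contactData c₂ z q = R₁.contactData c₁ z p) :
    R₂.solNormSq z q = R₁.solNormSq z p := by
  have h1 := sum_star_contactData hp hp
  have h2 := sum_star_contactData hq hq
  rw [h, h1, solInner_self, solInner_self] at h2
  have h3 := mul_left_cancel₀ (fun h0 => hz (Complex.conj_eq_iff_im.1 (sub_eq_zero.1 h0).symm)) h2
  exact (Complex.ofReal_injective h3).symm

/-- If the boundary data of solutions agree for non-real spectral parameters, then in the limit all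
boundary values on the first graph are boundary values on both graphs, with common boundary
derivatives. -/
theorem exists_common_contactData
    (hT : ∀ z : ℂ, z.im ≠ 0 → ∀ p ∈ R₁.solSpace ∅ (Set.range c₁)ᶜ z,
      ∃ q ∈ R₂.solSpace ∅ (Set.range c₂)ᶜ z, R₂.contactData c₂ z q = R₁.contactData c₁ z p)
    {z₀ : ℂ} (hz₀ : z₀.im = 0) {p : E₁ → ℂ × ℂ} (hp : p ∈ R₁.solSpace ∅ (Set.range c₁)ᶜ z₀) :
    ∃ p' ∈ R₁.solSpace ∅ (Set.range c₁)ᶜ z₀, ∃ q' ∈ R₂.solSpace ∅ (Set.range c₂)ᶜ z₀,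
      R₂.contactData c₂ z₀ q' = R₁.contactData c₁ z₀ p' ∧
      (R₁.contactData c₁ z₀ p').1 = (R₁.contactData c₁ z₀ p).1 := by
  obtain ⟨ε, hε0, hε1, hεt⟩ : ∃ ε : ℕ → ℝ, (∀ n, 0 < ε n) ∧ (∀ n, ε n ≤ 1) ∧
      Tendsto ε atTop (𝓝 0) :=
    ⟨fun n => 1 / ((n : ℝ) + 1), fun n => by positivity, fun n =>
      div_le_one_of_le₀ (by linarith [n.cast_nonneg (α := ℝ)]) (by positivity),
      tendsto_one_div_add_atTop_nhds_zero_nat⟩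
  obtain ⟨z, hz⟩ : ∃ z : ℕ → ℂ, ∀ n, z n = z₀ + ε n * Complex.I := ⟨_, fun _ => rfl⟩
  have hzim : ∀ n, (z n).im ≠ 0 := fun n => by
    rw [hz, Complex.add_im, hz₀, show ((ε n : ℂ) * Complex.I).im = ε n by simp, zero_add]
    exact (hε0 n).ne'
  have hzb : ∀ n, z n ∈ Metric.closedBall z₀ 1 := fun n => by
    simp [hz, abs_of_pos (hε0 n), hε1 n]
  have hzt : Tendsto z atTop (𝓝 z₀) := by
    have h1 : Tendsto (fun n => (ε n : ℂ)) atTop (𝓝 ((0 : ℝ) : ℂ)) :=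
      (Complex.continuous_ofReal.tendsto 0).comp hεt
    have h2 := (h1.mul_const Complex.I).const_add z₀
    rw [Complex.ofReal_zero, zero_mul, add_zero] at h2
    exact h2.congr fun n => (hz n).symm
  choose P hP hPf using fun n => exists_contactData_fst (Γ := R₁) (c := c₁) (hzim n)
    (R₁.contactData c₁ z₀ p).1
  choose Q hQ hQP using fun n => hT (z n) (hzim n) (P n) (hP n)
  obtain ⟨m₁, hm₁, hb₁⟩ := R₁.exists_le_solNormSq z₀
  obtain ⟨m₂, hm₂, hb₂⟩ := R₂.exists_le_solNormSq z₀
  obtain ⟨C, hC⟩ : ∃ C, C = R₁.solNormSq z₀ p := ⟨_, rfl⟩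
  have hPC : ∀ n, R₁.solNormSq (z n) (P n) ≤ C := fun n => hC ▸ hz n ▸ solNormSq_le_of_contactData_fst_eq hz₀ (hε0 n) hp (hz n ▸ hP n) (hz n ▸ hPf n)
  have hQC : ∀ n, R₂.solNormSq (z n) (Q n) ≤ C := fun n =>
    (solNormSq_eq_of_contactData_eq (hzim n) (hP n) (hQ n) (hQP n)).trans_le (hPC n)
  have hPb : ∀ n, ‖P n‖ ≤ Real.sqrt (C / m₁) := fun n => Real.le_sqrt_of_sq_le <| by
    rw [le_div_iff₀ hm₁, mul_comm]
    exact (hb₁ _ (hzb n) _).trans (hPC n)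
  have hQb : ∀ n, ‖Q n‖ ≤ Real.sqrt (C / m₂) := fun n => Real.le_sqrt_of_sq_le <| by
    rw [le_div_iff₀ hm₂, mul_comm]
    exact (hb₂ _ (hzb n) _).trans (hQC n)
  -- The limit `p'` may differ from `p`, but only by a solution with zero contact values.
  obtain ⟨⟨p', q'⟩, -, φ, hφ, hlim⟩ := tendsto_subseq_of_bounded
    (Metric.isBounded_closedBall (x := (0 : (E₁ → ℂ × ℂ) × (E₂ → ℂ × ℂ)))
      (r := max (Real.sqrt (C / m₁)) (Real.sqrt (C / m₂)))) (x := fun n => (P n, Q n)) fun n => by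
    rw [mem_closedBall_zero_iff, Prod.norm_mk]
    exact max_le_max (hPb n) (hQb n)
  have hzφ := hzt.comp hφ.tendsto_atTop
  have hPl : Tendsto (P ∘ φ) atTop (𝓝 p') := (continuous_fst.tendsto (p', q')).comp hlim
  have hQl : Tendsto (Q ∘ φ) atTop (𝓝 q') := (continuous_snd.tendsto (p', q')).comp hlim
  have hp' := mem_solSpace_of_tendsto hzφ hPl fun n => hP (φ n)
  have hq' := mem_solSpace_of_tendsto hzφ hQl fun n => hQ (φ n)
  have hPd := tendsto_contactData (Γ := R₁) (c := c₁) hzφ hPl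
  have hQd := tendsto_contactData (Γ := R₂) (c := c₂) hzφ hQl
  simp only [Function.comp_apply] at hPd hQd
  simp only [hQP] at hQd
  have hPd' := (continuous_fst.tendsto _).comp hPd
  simp only [Function.comp_def, hPf] at hPd'
  exact ⟨p', hp', q', hq', tendsto_nhds_unique hQd hPd,
    tendsto_nhds_unique hPd' tendsto_const_nhds⟩

/-- By maximality it is enough that the data of `p` are orthogonal to the data of each `q`. Let `p'`
and `q''` have common data and the contact values of `p` and `q`. The form splits into `ω(p', q) +
ω(p - p', q'') + ω(p - p', q - q'')`. The first term is isotropy on `R₂`, the second isotropy on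
`R₁`, and in the third both arguments have zero contact values. -/
theorem exists_contactData_eq_of_real
    (hT : ∀ z : ℂ, z.im ≠ 0 → ∀ p ∈ R₁.solSpace ∅ (Set.range c₁)ᶜ z,
      ∃ q ∈ R₂.solSpace ∅ (Set.range c₂)ᶜ z, R₂.contactData c₂ z q = R₁.contactData c₁ z p)
    (hT' : ∀ z : ℂ, z.im ≠ 0 → ∀ q ∈ R₂.solSpace ∅ (Set.range c₂)ᶜ z,
      ∃ p ∈ R₁.solSpace ∅ (Set.range c₁)ᶜ z, R₁.contactData c₁ z p = R₂.contactData c₂ z q)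
    {z : ℂ} (hz : z.im = 0) {p : E₁ → ℂ × ℂ} (hp : p ∈ R₁.solSpace ∅ (Set.range c₁)ᶜ z) :
    ∃ q ∈ R₂.solSpace ∅ (Set.range c₂)ᶜ z, R₂.contactData c₂ z q = R₁.contactData c₁ z p := by
  refine exists_contactData_eq fun q hq => ?_
  obtain ⟨p', hp', q', hq', h1, h2⟩ := exists_common_contactData hT hz hp
  obtain ⟨q'', hq'', p'', hp'', h3, h4⟩ := exists_common_contactData hT' hz hq
  have i1 := sum_contactData hq' hq
  have i2 := sum_contactData (Submodule.sub_mem _ hp hp') hp''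
  rw [h1] at i1
  rw [map_sub, map_sub, LinearMap.sub_apply, h3] at i2
  have i3 : symplecticForm B (R₁.contactData c₁ z p - R₁.contactData c₁ z p')
      (R₂.contactData c₂ z q - R₂.contactData c₂ z q'') = 0 := by
    rw [symplecticForm_apply]
    refine Finset.sum_eq_zero fun b _ => ?_
    have e1 : (R₁.contactData c₁ z p - R₁.contactData c₁ z p').1 b = 0 := by
      rw [Prod.fst_sub, h2, sub_self]; rfl
    have e2 : (R₂.contactData c₂ z q - R₂.contactData c₂ z q'').1 b = 0 := by
      rw [Prod.fst_sub, h4, sub_self]; rfl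
    rw [e1, e2, zero_mul, mul_zero, sub_zero]
  simp only [map_sub, LinearMap.sub_apply] at i3
  linear_combination i1 + i2 + i3

end Transfer

/-! ### Boundary data and the `M`-function. -/

section MFunction

variable {E V B : Type*} {Γ : MetricGraph E V} {c : B ↪ V}

/-- The initial data of a function on the edges. -/
noncomputable def initialData (Γ : MetricGraph E V) (u : E → ℝ → ℂ) (e : E) : ℂ × ℂ :=
  (u e 0, derivWithin (u e) (Set.Icc 0 (Γ.length e)) 0)

theorem endValue_eq_solValue {z : ℂ} {u : E → ℝ → ℂ}
    (h : ∀ e, IsW22 (Γ.length e) (u e) (fun x => -(z * u e x))) :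
    Γ.endValue u = Γ.solValue z (Γ.initialData u) := by
  funext ⟨e, s⟩
  refine ((h e).eq_sol (Γ.length_pos e) ?_).1
  have := (Γ.length_pos e).le
  cases s <;> simpa

theorem endDeriv_eq_solDeriv {z : ℂ} {u : E → ℝ → ℂ}
    (h : ∀ e, IsW22 (Γ.length e) (u e) (fun x => -(z * u e x))) :
    Γ.endDeriv u = Γ.solDeriv z (Γ.initialData u) := by
  funext ⟨e, s⟩
  have hl := (Γ.length_pos e).le
  cases s
  · rw [solDeriv_false]
    rfl
  · rw [solDeriv_true]
    exact congrArg Neg.neg ((h e).eq_sol (Γ.length_pos e) ⟨hl, le_rfl⟩).2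

variable [Fintype E]

theorem isSolution_sol {z : ℂ} {p : E → ℂ × ℂ} (hp : p ∈ Γ.solSpace ∅ (Set.range c)ᶜ z) :
    Γ.IsSolution c z fun e => sol z (p e) := by
  refine ⟨fun e => isW22_sol (Γ.length_pos e) z (p e), hp.1, fun v hv => ?_⟩
  rw [vertexDeriv, endDeriv_sol]
  exact hp.2.2 v hv

theorem initialData_mem_solSpace {z : ℂ} {u : E → ℝ → ℂ} {N : Set V}
    (h1 : ∀ e, IsW22 (Γ.length e) (u e) (fun x => -(z * u e x))) (h2 : Γ.ContinuousAtVertices u)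
    (h3 : ∀ v ∈ N, Γ.vertexDeriv u v = 0) : Γ.initialData u ∈ Γ.solSpace ∅ N z := by
  refine Γ.mem_solSpace.2 ⟨fun x y hxy => ?_, fun _ h => h.elim, fun v hv => ?_⟩
  · rw [← endValue_eq_solValue h1]
    exact h2 x y hxy
  · rw [← endDeriv_eq_solDeriv h1]
    exact h3 v hv

/-- The solution chosen in `mFunction` has the initial data `p`, because a solution is determined by
its contact values for non-real `z`. -/
theorem mFunction_contactData [Fintype V] [Fintype B] {z : ℂ} (hz : z.im ≠ 0) {p : E → ℂ × ℂ}
    (hp : p ∈ Γ.solSpace ∅ (Set.range c)ᶜ z) :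
    Γ.mFunction c z (Γ.contactData c z p).1 = (Γ.contactData c z p).2 := by
  have hex : ∃ u, Γ.IsSolution c z u ∧ Γ.HasBoundaryValues c u (Γ.contactData c z p).1 :=
    ⟨_, isSolution_sol hp, fun x b hx => by rw [endValue_sol, contactData_fst hp hx]⟩
  rw [mFunction, dif_pos hex]
  obtain ⟨hs, hb⟩ := hex.choose_spec
  set u := hex.choose
  have hm := initialData_mem_solSpace hs.1 hs.2.1 hs.2.2
  have hu : Γ.initialData u = p := by
    refine sub_eq_zero.1 (eq_zero_of_contactData_fst hz (Submodule.sub_mem _ hm hp) ?_)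
    rw [map_sub, Prod.fst_sub, sub_eq_zero]
    funext b
    have hx := Function.surjInv_eq Γ.vert_surjective (c b)
    rw [contactData_fst hm hx, ← endValue_eq_solValue hs.1, hb _ b hx]
  funext b
  rw [contactData_snd, ← hu, ← endDeriv_eq_solDeriv hs.1]
  rfl

/-- Graphs with equal `M`-functions have the same boundary data of solutions, for all spectral
parameters. -/
theorem exists_contactData_eq_of_mFunction_eq {E₁ V₁ E₂ V₂ : Type*} [Fintype E₁] [Fintype E₂]
    [Fintype V₁] [Fintype V₂] [Fintype B] {R₁ : MetricGraph E₁ V₁} {R₂ : MetricGraph E₂ V₂}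
    {c₁ : B ↪ V₁} {c₂ : B ↪ V₂}
    (hM : ∀ z : ℂ, z.im ≠ 0 → R₁.mFunction c₁ z = R₂.mFunction c₂ z) (z : ℂ) {p : E₁ → ℂ × ℂ}
    (hp : p ∈ R₁.solSpace ∅ (Set.range c₁)ᶜ z) :
    ∃ q ∈ R₂.solSpace ∅ (Set.range c₂)ᶜ z, R₂.contactData c₂ z q = R₁.contactData c₁ z p := by
  have hT : ∀ z : ℂ, z.im ≠ 0 → ∀ p ∈ R₁.solSpace ∅ (Set.range c₁)ᶜ z,
      ∃ q ∈ R₂.solSpace ∅ (Set.range c₂)ᶜ z, R₂.contactData c₂ z q = R₁.contactData c₁ z p := by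
    intro z hz p hp
    obtain ⟨q, hq, hqf⟩ := exists_contactData_fst (Γ := R₂) (c := c₂) hz (R₁.contactData c₁ z p).1
    refine ⟨q, hq, Prod.ext hqf ?_⟩
    rw [← mFunction_contactData hz hq, ← mFunction_contactData hz hp, hqf, hM z hz]
  have hT' : ∀ z : ℂ, z.im ≠ 0 → ∀ q ∈ R₂.solSpace ∅ (Set.range c₂)ᶜ z,
      ∃ p ∈ R₁.solSpace ∅ (Set.range c₁)ᶜ z, R₁.contactData c₁ z p = R₂.contactData c₂ z q := by
    intro z hz q hq
    obtain ⟨p, hp, hpf⟩ := exists_contactData_fst (Γ := R₁) (c := c₁) hz (R₂.contactData c₂ z q).1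
    refine ⟨p, hp, Prod.ext hpf ?_⟩
    rw [← mFunction_contactData hz hp, ← mFunction_contactData hz hq, hpf, hM z hz]
  rcases eq_or_ne z.im 0 with hz | hz
  · exact exists_contactData_eq_of_real hT hT' hz hp
  · exact hT z hz p hp

end MFunction

end MetricGraph

/-! ### Eigenspaces and spectrum in terms of solution spaces. -/

/-- The class in `L₂(0, ℓ)` of the solution of `-u'' = z u` with given initial data. -/
noncomputable def solLp (ℓ : ℝ) (z : ℂ) :
    (ℂ × ℂ) →ₗ[ℂ] Lp ℂ 2 (volume.restrict (Set.Icc 0 ℓ)) where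
  toFun p := (continuous_sol_right z p).continuousOn.memLp_Icc.toLp
  map_add' p q := by
    rw [← MemLp.toLp_add]
    congr 1
    funext x
    simp [sol]
  map_smul' a p := by
    rw [RingHom.id_apply, ← MemLp.toLp_const_smul]
    congr 1
    funext x
    simp [sol]

theorem coeFn_solLp (ℓ : ℝ) (z : ℂ) (p : ℂ × ℂ) :
    solLp ℓ z p =ᵐ[volume.restrict (Set.Icc 0 ℓ)] sol z p :=
  (continuous_sol_right z p).continuousOn.memLp_Icc.coeFn_toLp

theorem solLp_injective {ℓ : ℝ} (hℓ : 0 < ℓ) (z : ℂ) : Function.Injective (solLp ℓ z) := by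
  rw [← LinearMap.ker_eq_bot, LinearMap.ker_eq_bot']
  intro p hp
  have h := coeFn_solLp ℓ z p
  rw [hp] at h
  exact sol_eq_zero hℓ (Measure.eqOn_Icc_of_ae_eq volume hℓ.ne
    (h.symm.trans (Lp.coeFn_zero ℂ 2 _)) (continuous_sol_right z p).continuousOn continuousOn_const)

namespace MetricGraph

section Spectrum

variable {E V : Type*} (Γ : MetricGraph E V)

/-- The element of `L₂(Γ)` given by the solution of `-u'' = z u` with given initial data. -/
noncomputable def solL2 (z : ℂ) : (E → ℂ × ℂ) →ₗ[ℂ] Γ.L2 :=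
  (WithLp.linearEquiv 2 ℂ _).symm.toLinearMap ∘ₗ
    LinearMap.pi fun e => solLp (Γ.length e) z ∘ₗ LinearMap.proj e

theorem solL2_apply (z : ℂ) (p : E → ℂ × ℂ) (e : E) :
    Γ.solL2 z p e = solLp (Γ.length e) z (p e) := rfl

theorem solL2_injective (z : ℂ) : Function.Injective (Γ.solL2 z) := by
  intro p q h
  funext e
  refine solLp_injective (Γ.length_pos e) z ?_
  rw [← solL2_apply, h, solL2_apply]

variable [Fintype E]

theorem eigenspace_eq_map (z : ℂ) :
    Γ.eigenspace z = (Γ.solSpace ∅ Set.univ z).map (Γ.solL2 z) := by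
  ext f
  constructor
  · rintro ⟨u, h1, h2, h3, h4⟩
    have h5 : ∀ e, IsW22 (Γ.length e) (u e) (fun x => -(z * u e x)) := fun e => by
      refine (h2 e).congr_ae ?_
      filter_upwards [h1 e, Lp.coeFn_smul z (f e)] with x hx hx'
      change -((z • f e : Lp ℂ 2 (volume.restrict (Set.Icc 0 (Γ.length e)))) x) = _
      rw [hx', hx]
      rfl
    refine ⟨Γ.initialData u, initialData_mem_solSpace h5 h3 fun v _ => h4 v, ?_⟩
    refine PiLp.ext fun e => Lp.ext ?_
    rw [solL2_apply]
    refine (coeFn_solLp _ _ _).trans (Filter.EventuallyEq.trans ?_ (h1 e))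
    filter_upwards [ae_restrict_mem measurableSet_Icc] with x hx
    exact ((h5 e).eq_sol (Γ.length_pos e) hx).1.symm
  · rintro ⟨p, hp, rfl⟩
    refine ⟨fun e => sol z (p e), fun e => (coeFn_solLp _ _ _).symm, fun e => ?_, hp.1, fun v => ?_⟩
    · refine (isW22_sol (Γ.length_pos e) z (p e)).congr_ae ?_
      filter_upwards [coeFn_solLp (Γ.length e) z (p e),
        Lp.coeFn_smul z (solLp (Γ.length e) z (p e))] with x hx hx'
      change _ = -((z • solLp (Γ.length e) z (p e)) x)
      rw [hx', Pi.smul_apply, hx]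
      rfl
    · rw [vertexDeriv, endDeriv_sol]
      exact hp.2.2 v trivial

/-- The inhomogeneous equation is solvable if the homogeneous one has only the zero solution. -/
theorem exists_mem_laplacianGraph {z : ℂ} (hz : Γ.solSpace ∅ Set.univ z = ⊥) (h : Γ.L2) :
    ∃ f : Γ.L2, (f, z • f + h) ∈ Γ.laplacianGraph := by
  classical
  choose w hw using fun e => exists_isW22 (Γ.length_pos e) z (Lp.memLp (h e))
  -- The edgewise particular solution `w` violates the vertex conditions; subtracting the
  -- homogeneous solution given by `p` restores them.
  obtain ⟨p, hp⟩ := Γ.exists_sub_trace_mem (z := z) (D := ∅) (N := Set.univ)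
    (t := (Γ.endValue w, Γ.endDeriv w)) (by
      intro p hp
      have hp' : p ∈ Γ.solSpace ∅ Set.univ z := hp
      rw [hz, Submodule.mem_bot] at hp'
      rw [hp', map_zero, map_zero])
  have hW : ∀ e, IsW22 (Γ.length e) (w e + sol z (-p e))
      ((fun x => -(z * w e x + h e x)) + fun x => -(z * sol z (-p e) x)) := fun e =>
    (hw e).add (Γ.length_pos e) (isW22_sol (Γ.length_pos e) z (-p e))
  set u : E → ℝ → ℂ := w + fun e => sol z ((-p) e) with hu
  have hmem : ∀ e, MemLp (u e) 2 (volume.restrict (Set.Icc 0 (Γ.length e))) := fun e =>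
    (hW e).differentiableOn.continuousOn.memLp_Icc
  have hv : ∀ x, Γ.endValue u x = Γ.endValue w x - Γ.solValue z p x := fun x => by
    rw [sub_eq_add_neg, ← Pi.neg_apply, ← map_neg]
    rfl
  have hd : ∀ x, Γ.endDeriv u x = Γ.endDeriv w x - Γ.solDeriv z p x := fun x => by
    rw [sub_eq_add_neg, ← Pi.neg_apply, ← map_neg, ← endDeriv_sol]
    exact Γ.endDeriv_add (fun e => (hw e).differentiableOn)
      (fun e => (isW22_sol (Γ.length_pos e) z _).differentiableOn) x
  obtain ⟨h1, -, h3⟩ := Γ.mem_boundarySpace.1 hp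
  refine ⟨WithLp.toLp 2 fun e => (hmem e).toLp, u, fun e => (hmem e).coeFn_toLp.symm, fun e => ?_,
    fun x y hxy => ?_, fun v => ?_⟩
  · refine (hW e).congr_ae ?_
    filter_upwards [(hmem e).coeFn_toLp, Lp.coeFn_smul z ((hmem e).toLp),
      Lp.coeFn_add (z • (hmem e).toLp) (h e)] with x hx hx' hx''
    change _ = -((z • (hmem e).toLp + h e) x)
    rw [Pi.add_apply, hx', Pi.smul_apply, hx, smul_eq_mul] at hx''
    rw [hx'']
    change -(z * w e x + h e x) + -(z * sol z (-p e) x) = -(z * (w e x + sol z (-p e) x) + h e x)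
    ring
  · rw [hv, hv]
    exact h1 x y hxy
  · have h4 := h3 v (by simp)
    rw [vertexDeriv]
    simp only [hd]
    exact h4

theorem mem_spectrum_iff {z : ℂ} : z ∈ Γ.spectrum ↔ Γ.solSpace ∅ Set.univ z ≠ ⊥ := by
  rw [spectrum, Set.mem_ofPred_eq, not_iff_not]
  have hbot : Γ.solSpace ∅ Set.univ z = ⊥ ↔ Γ.eigenspace z = ⊥ := by
    rw [eigenspace_eq_map, ← Submodule.subsingleton_iff_eq_bot, ← Submodule.subsingleton_iff_eq_bot]
    exact (Submodule.equivMapOfInjective _ (Γ.solL2_injective z) _).toEquiv.subsingleton_congr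
  constructor
  · intro h
    rw [hbot, Submodule.eq_bot_iff]
    intro f hf
    -- Uniqueness for the right hand side `0` says that the kernel is trivial.
    obtain ⟨g, -, hg⟩ := h 0
    simp only [add_zero] at hg
    rw [hg f hf]
    refine (hg 0 ?_).symm
    rw [smul_zero]
    exact Γ.laplacianGraph.zero_mem
  · intro h f
    obtain ⟨g, hg⟩ := Γ.exists_mem_laplacianGraph h f
    refine ⟨g, hg, fun g' hg' => ?_⟩
    have h1 : g' - g ∈ Γ.eigenspace z := by
      have h2 := Γ.laplacianGraph.sub_mem hg' hg
      rw [Prod.mk_sub_mk, add_sub_add_right_eq_sub, ← smul_sub] at h2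
      exact h2
    rw [hbot.1 h, Submodule.mem_bot] at h1
    exact sub_eq_zero.1 h1

variable {Γ} {Γ' : MetricGraph E V}

/-- Graphs are isospectral if for every spectral parameter their spaces of solutions that satisfy the
standard conditions are isomorphic. -/
theorem isospectral_of_solSpace_equiv
    (h : ∀ z, Nonempty (Γ.solSpace ∅ Set.univ z ≃ₗ[ℂ] Γ'.solSpace ∅ Set.univ z)) :
    Γ.Isospectral Γ' := by
  refine ⟨?_, fun z => ?_⟩
  · ext z
    obtain ⟨φ⟩ := h z
    rw [mem_spectrum_iff, mem_spectrum_iff, not_iff_not, ← Submodule.subsingleton_iff_eq_bot,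
      ← Submodule.subsingleton_iff_eq_bot]
    exact φ.toEquiv.subsingleton_congr
  · obtain ⟨φ⟩ := h z
    congr 1
    rw [eigenspace_eq_map, eigenspace_eq_map]
    exact ((Submodule.equivMapOfInjective _ (Γ.solL2_injective z) _).symm.trans
      (φ.trans (Submodule.equivMapOfInjective _ (Γ'.solL2_injective z) _))).rank_eq

end Spectrum

end MetricGraph

/-! ### Subgraphs, and transplantation of solutions to the exchanged graph. -/

theorem Finset.sum_eq_sum_embedding_add {X Y₁ Y₂ M : Type*} [Fintype X] [Fintype Y₁] [Fintype Y₂]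
    [DecidableEq X] [AddCommMonoid M] (i₁ : Y₁ ↪ X) (i₂ : Y₂ ↪ X) (h : ∀ y₁ y₂, i₁ y₁ ≠ i₂ y₂)
    (f : X → M) :
    ∑ x, f x = ∑ y, f (i₁ y) + (∑ y, f (i₂ y) +
      ∑ x ∈ (Finset.univ.map i₁ ∪ Finset.univ.map i₂)ᶜ, f x) := by
  have hd : Disjoint (Finset.univ.map i₁) (Finset.univ.map i₂) := by
    rw [Finset.disjoint_left]
    intro x h1 h2
    obtain ⟨y₁, -, rfl⟩ := Finset.mem_map.1 h1
    obtain ⟨y₂, -, h3⟩ := Finset.mem_map.1 h2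
    exact h y₁ y₂ h3.symm
  rw [← Finset.sum_map Finset.univ i₁ f, ← Finset.sum_map Finset.univ i₂ f, ← add_assoc,
    ← Finset.sum_union hd, Finset.sum_add_sum_compl]

/-- Every linear map between vector spaces has a generalized inverse. -/
theorem LinearMap.exists_generalizedInverse {K U W : Type*} [Field K] [AddCommGroup U] [Module K U]
    [AddCommGroup W] [Module K W] (f : U →ₗ[K] W) : ∃ g : W →ₗ[K] U, ∀ u, f (g (f u)) = f u := by
  obtain ⟨g, hg⟩ := f.rangeRestrict.exists_rightInverse_of_surjective f.range_rangeRestrict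
  obtain ⟨g', hg'⟩ := g.exists_extend
  refine ⟨g', fun u => ?_⟩
  have h1 : g' (f u) = g (f.rangeRestrict u) := LinearMap.congr_fun hg' (f.rangeRestrict u)
  have h2 := LinearMap.congr_fun hg (f.rangeRestrict u)
  rw [h1]
  exact congrArg Subtype.val h2

/-- Extension by zero along an injection, as a linear map. -/
noncomputable def Function.Embedding.extendZero {ι η : Type*} (j : ι ↪ η) (K M : Type*) [Semiring K]
    [AddCommMonoid M] [Module K M] : (ι → M) →ₗ[K] (η → M) where
  toFun q := Function.extend j q 0
  map_add' p q := by
    rw [← Function.extend_add, add_zero]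
  map_smul' a q := by
    rw [RingHom.id_apply, ← Function.extend_smul, smul_zero]

namespace MetricGraph

namespace Inclusion

variable {E V E' V' B : Type*} {R : MetricGraph E' V'} {c : B ↪ V'} {Γ : MetricGraph E V}
  (ι : Inclusion R c Γ)

/-- The inclusion of the end points of a subgraph. -/
def endPoint : E' × Bool ↪ E × Bool :=
  ι.edge.prodMap (Function.Embedding.refl Bool)

theorem endPoint_apply (x : E' × Bool) : ι.endPoint x = (ι.edge x.1, x.2) := rfl

theorem vert_endPoint (x : E' × Bool) : Γ.vert (ι.endPoint x) = ι.vertex (R.vert x) :=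
  ι.vert_edge x.1 x.2

theorem exists_endPoint {w : V'} (hw : w ∉ Set.range c) {x : E × Bool}
    (hx : Γ.vert x = ι.vertex w) : ∃ y, ι.endPoint y = x ∧ R.vert y = w := by
  obtain ⟨e, s, h1, h2⟩ := ι.inner w hw x hx
  exact ⟨(e, s), h1, h2⟩

theorem solValue_comp_edge (z : ℂ) (p : E → ℂ × ℂ) (x : E' × Bool) :
    R.solValue z (p ∘ ι.edge) x = Γ.solValue z p (ι.endPoint x) := by
  rw [solValue_apply, solValue_apply, endPoint_apply, ι.length_edge]
  rfl

theorem solDeriv_comp_edge (z : ℂ) (p : E → ℂ × ℂ) (x : E' × Bool) :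
    R.solDeriv z (p ∘ ι.edge) x = Γ.solDeriv z p (ι.endPoint x) := by
  rw [solDeriv_apply, solDeriv_apply, endPoint_apply, ι.length_edge]
  rfl

variable [Fintype E] [Fintype E']

/-- At a non-contact vertex all ends in `Γ` belong to the subgraph, so the Kirchhoff sums on `R` and
on `Γ` coincide. -/
theorem comp_edge_mem_solSpace {z : ℂ} {p : E → ℂ × ℂ} (hp : p ∈ Γ.solSpace ∅ Set.univ z) :
    p ∘ ι.edge ∈ R.solSpace ∅ (Set.range c)ᶜ z := by
  classical
  obtain ⟨h1, -, h3⟩ := Γ.mem_solSpace.1 hp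
  refine R.mem_solSpace.2 ⟨fun x y hxy => ?_, fun _ h => h.elim, fun w hw => ?_⟩
  · rw [ι.solValue_comp_edge, ι.solValue_comp_edge]
    exact h1 _ _ (by rw [ι.vert_endPoint, ι.vert_endPoint, hxy])
  · rw [← h3 (ι.vertex w) trivial]
    simp only [ι.solDeriv_comp_edge]
    rw [← Finset.sum_map _ ι.endPoint]
    refine Finset.sum_congr (Finset.ext fun x => ?_) fun _ _ => rfl
    simp only [Finset.mem_map, Finset.mem_filter, Finset.mem_univ, true_and]
    constructor
    · rintro ⟨y, rfl, rfl⟩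
      exact ι.vert_endPoint y
    · intro hx
      obtain ⟨y, h4, h5⟩ := ι.exists_endPoint hw hx
      exact ⟨y, h5, h4⟩

end Inclusion

section Swap

variable {E V E₁ V₁ E₂ V₂ B : Type*} {Γ Γ' : MetricGraph E V}
  {R₁ : MetricGraph E₁ V₁} {R₂ : MetricGraph E₂ V₂} {c₁ : B ↪ V₁} {c₂ : B ↪ V₂}

/-- The graph `Γ'` arises from `Γ` by exchanging the subgraphs `R₁` and `R₂`, which have the same
edges in both graphs. -/
structure IsExchange (ι₁ : Inclusion R₁ c₁ Γ) (ι₂ : Inclusion R₂ c₂ Γ) (κ₁ : Inclusion R₁ c₁ Γ')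
    (κ₂ : Inclusion R₂ c₂ Γ') : Prop where
  length_eq : Γ.length = Γ'.length
  disjoint : ∀ e₁ e₂, ι₁.edge e₁ ≠ ι₂.edge e₂
  edge_left : ι₁.edge = κ₁.edge
  edge_right : ι₂.edge = κ₂.edge
  vertex_left : ∀ b, ι₁.vertex (c₁ b) = κ₂.vertex (c₂ b)
  vertex_right : ∀ b, ι₂.vertex (c₂ b) = κ₁.vertex (c₁ b)
  vert_eq : ∀ x : E × Bool, x.1 ∉ Set.range ι₁.edge → x.1 ∉ Set.range ι₂.edge → Γ.vert x = Γ'.vert x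

variable {ι₁ : Inclusion R₁ c₁ Γ} {ι₂ : Inclusion R₂ c₂ Γ} {κ₁ : Inclusion R₁ c₁ Γ'}
  {κ₂ : Inclusion R₂ c₂ Γ'}

theorem IsExchange.symm (h : IsExchange ι₁ ι₂ κ₁ κ₂) : IsExchange κ₁ κ₂ ι₁ ι₂ where
  length_eq := h.length_eq.symm
  disjoint := h.edge_left ▸ h.edge_right ▸ h.disjoint
  edge_left := h.edge_left.symm
  edge_right := h.edge_right.symm
  vertex_left b := (h.vertex_right b).symm
  vertex_right b := (h.vertex_left b).symm
  vert_eq x h1 h2 := (h.vert_eq x (h.edge_left ▸ h1) (h.edge_right ▸ h2)).symm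

theorem IsExchange.endPoint_left (h : IsExchange ι₁ ι₂ κ₁ κ₂) : ι₁.endPoint = κ₁.endPoint := by
  rw [Inclusion.endPoint, Inclusion.endPoint, h.edge_left]

theorem IsExchange.endPoint_right (h : IsExchange ι₁ ι₂ κ₁ κ₂) : ι₂.endPoint = κ₂.endPoint := by
  rw [Inclusion.endPoint, Inclusion.endPoint, h.edge_right]

theorem IsExchange.solValue_eq (h : IsExchange ι₁ ι₂ κ₁ κ₂) : Γ.solValue = Γ'.solValue := by
  funext z
  ext p x
  simp only [solValue, h.length_eq]

theorem IsExchange.solDeriv_eq (h : IsExchange ι₁ ι₂ κ₁ κ₂) : Γ.solDeriv = Γ'.solDeriv := by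
  funext z
  ext p x
  simp only [solDeriv, h.length_eq]

/-- At `c₁ b` the new function takes the old value at `c₂ b`, and in `Γ'` the contact `c₁ b` sits
where `c₂ b` was. So the old potential `F` still describes the values. -/
theorem IsExchange.solValue_contact [Fintype E] [Fintype E₁] [Fintype E₂]
    (h : IsExchange ι₁ ι₂ κ₁ κ₂) {z : ℂ} {p p' : E → ℂ × ℂ}
    (hp : p ∈ Γ.solSpace ∅ Set.univ z) (hp₁ : p' ∘ ι₁.edge ∈ R₁.solSpace ∅ (Set.range c₁)ᶜ z)
    (h₁ : R₁.contactData c₁ z (p' ∘ ι₁.edge) = R₂.contactData c₂ z (p ∘ ι₂.edge))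
    {F : V → ℂ} (hF : ∀ x, Γ.solValue z p x = F (Γ.vert x)) {y : E₁ × Bool} {b : B}
    (hy : R₁.vert y = c₁ b) : Γ.solValue z p' (ι₁.endPoint y) = F (Γ'.vert (ι₁.endPoint y)) := by
  obtain ⟨y₂, hy₂⟩ := R₂.vert_surjective (c₂ b)
  rw [← ι₁.solValue_comp_edge, ← contactData_fst hp₁ hy, h₁,
    contactData_fst (ι₂.comp_edge_mem_solSpace hp) hy₂, ι₂.solValue_comp_edge, hF, h.endPoint_left,
    ι₂.vert_endPoint, κ₁.vert_endPoint, hy, hy₂, h.vertex_right]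

theorem solValue_eq_of_inner [Fintype E₁] {z : ℂ} {p : E → ℂ × ℂ}
    (hp : p ∘ κ₁.edge ∈ R₁.solSpace ∅ (Set.range c₁)ᶜ z) {y : E₁ × Bool}
    (hy : R₁.vert y ∉ Set.range c₁) {x : E × Bool} (hx : Γ'.vert x = Γ'.vert (κ₁.endPoint y)) :
    Γ'.solValue z p x = Γ'.solValue z p (κ₁.endPoint y) := by
  rw [κ₁.vert_endPoint] at hx
  obtain ⟨y', rfl, hy'⟩ := κ₁.exists_endPoint hy hx
  rw [← κ₁.solValue_comp_edge, ← κ₁.solValue_comp_edge]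
  exact (R₁.mem_solSpace.1 hp).1 _ _ hy'

/-- Both sums reduce to the contact vertices, where derivatives and positions agree: after the
exchange `R₁` contributes to each vertex what `R₂` did before. -/
theorem IsExchange.sum_eq [Fintype E₁] [Fintype E₂] [Fintype V₁] [Fintype V₂] [Fintype B]
    (h : IsExchange ι₁ ι₂ κ₁ κ₂) {z : ℂ} {p p' : E → ℂ × ℂ} (hp₂ : p ∘ ι₂.edge ∈ R₂.solSpace ∅ (Set.range c₂)ᶜ z)
    (hp₁ : p' ∘ ι₁.edge ∈ R₁.solSpace ∅ (Set.range c₁)ᶜ z)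
    (h₁ : R₁.contactData c₁ z (p' ∘ ι₁.edge) = R₂.contactData c₂ z (p ∘ ι₂.edge)) (H : V → ℂ) :
    ∑ y, H (Γ'.vert (ι₁.endPoint y)) * Γ.solDeriv z p' (ι₁.endPoint y) =
      ∑ y, H (Γ.vert (ι₂.endPoint y)) * Γ.solDeriv z p (ι₂.endPoint y) := by
  have e1 := sum_vert_mul_solDeriv hp₁ fun w => H (κ₁.vertex w)
  have e2 := sum_vert_mul_solDeriv hp₂ fun w => H (ι₂.vertex w)
  simp only [Inclusion.solDeriv_comp_edge, ← Inclusion.vert_endPoint] at e1 e2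
  rw [← h.endPoint_left] at e1
  rw [e1, e2, h₁]
  exact Finset.sum_congr rfl fun b _ => by rw [h.vertex_right]

/-- A function on `Γ` that satisfies the standard conditions gives one on the exchanged graph, if it is
modified on the two subgraphs such that their boundary data are interchanged. -/
theorem IsExchange.mem_solSpace [Fintype E] [Fintype E₁] [Fintype E₂] [Fintype V₁] [Fintype V₂]
    [Fintype B] (h : IsExchange ι₁ ι₂ κ₁ κ₂) {z : ℂ} {p p' : E → ℂ × ℂ} (hp : p ∈ Γ.solSpace ∅ Set.univ z)
    (hp₁ : p' ∘ ι₁.edge ∈ R₁.solSpace ∅ (Set.range c₁)ᶜ z)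
    (hp₂ : p' ∘ ι₂.edge ∈ R₂.solSpace ∅ (Set.range c₂)ᶜ z)
    (h₁ : R₁.contactData c₁ z (p' ∘ ι₁.edge) = R₂.contactData c₂ z (p ∘ ι₂.edge))
    (h₂ : R₂.contactData c₂ z (p' ∘ ι₂.edge) = R₁.contactData c₁ z (p ∘ ι₁.edge))
    (hpp : ∀ e, e ∉ Set.range ι₁.edge → e ∉ Set.range ι₂.edge → p' e = p e) :
    p' ∈ Γ'.solSpace ∅ Set.univ z := by
  classical
  have hflip : IsExchange ι₂ ι₁ κ₂ κ₁ :=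
    ⟨h.length_eq, fun e₂ e₁ => (h.disjoint e₁ e₂).symm, h.edge_right, h.edge_left, h.vertex_right,
      h.vertex_left, fun x h1 h2 => h.vert_eq x h2 h1⟩
  obtain ⟨F, hF, -⟩ := exists_potential (c := (Function.Embedding.ofIsEmpty : Empty ↪ V)) hp
  -- Every end is at an inner vertex of a subgraph, where continuity is inherited from that
  -- subgraph, or takes its value from the old potential at its new vertex.
  have key : ∀ x : E × Bool, (∃ y, κ₁.endPoint y = x ∧ R₁.vert y ∉ Set.range c₁) ∨
      (∃ y, κ₂.endPoint y = x ∧ R₂.vert y ∉ Set.range c₂) ∨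
      Γ'.solValue z p' x = F (Γ'.vert x) := by
    rintro ⟨e, s⟩
    rw [← h.solValue_eq, ← h.endPoint_left, ← h.endPoint_right]
    by_cases hx₁ : e ∈ Set.range ι₁.edge
    · obtain ⟨e, rfl⟩ := hx₁
      obtain ⟨y, hy⟩ : ∃ y, ι₁.endPoint y = (ι₁.edge e, s) := ⟨(e, s), rfl⟩
      rw [← hy]
      by_cases hb : R₁.vert y ∈ Set.range c₁
      · obtain ⟨b, hb⟩ := hb
        right; right
        exact h.solValue_contact hp hp₁ h₁ hF hb.symm
      · exact .inl ⟨y, rfl, hb⟩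
    by_cases hx₂ : e ∈ Set.range ι₂.edge
    · obtain ⟨e, rfl⟩ := hx₂
      obtain ⟨y, hy⟩ : ∃ y, ι₂.endPoint y = (ι₂.edge e, s) := ⟨(e, s), rfl⟩
      rw [← hy]
      by_cases hb : R₂.vert y ∈ Set.range c₂
      · obtain ⟨b, hb⟩ := hb
        right; right
        exact hflip.solValue_contact hp hp₂ h₂ hF hb.symm
      · exact .inr (.inl ⟨y, rfl, hb⟩)
    · refine .inr (.inr ?_)
      rw [← h.vert_eq (e, s) hx₁ hx₂, ← hF, solValue_apply, solValue_apply, hpp _ hx₁ hx₂]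
  rw [h.edge_left] at hp₁
  rw [h.edge_right] at hp₂
  refine Γ'.mem_solSpace.2 ⟨fun x y hxy => ?_, fun _ h => h.elim, fun v _ => ?_⟩
  · rcases key x with ⟨x', rfl, hx⟩ | ⟨x', rfl, hx⟩ | hx
    · exact (solValue_eq_of_inner hp₁ hx hxy.symm).symm
    · exact (solValue_eq_of_inner hp₂ hx hxy.symm).symm
    rcases key y with ⟨y', rfl, hy⟩ | ⟨y', rfl, hy⟩ | hy
    · exact solValue_eq_of_inner hp₁ hy hxy
    · exact solValue_eq_of_inner hp₂ hy hxy
    rw [hx, hy, hxy]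
  · rw [← h.edge_left] at hp₁
    rw [← h.edge_right] at hp₂
    -- Weighting by the indicator of `v` turns the Kirchhoff sum into a sum over all ends, which
    -- splits into `R₁`, `R₂` and the rest. The first two parts trade places, whatever kind of
    -- vertex `v` is.
    set H : V → ℂ := fun w => if w = v then 1 else 0 with hH
    have hd : ∀ y₁ y₂, ι₁.endPoint y₁ ≠ ι₂.endPoint y₂ := fun y₁ y₂ h0 =>
      h.disjoint _ _ (congrArg Prod.fst h0)
    have e1 := Finset.sum_eq_sum_embedding_add ι₁.endPoint ι₂.endPoint hd
      fun x => H (Γ'.vert x) * Γ.solDeriv z p' x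
    have e2 := Finset.sum_eq_sum_embedding_add ι₁.endPoint ι₂.endPoint hd
      fun x => H (Γ.vert x) * Γ.solDeriv z p x
    have e3 : ∑ x ∈ (Finset.univ.map ι₁.endPoint ∪ Finset.univ.map ι₂.endPoint)ᶜ,
        H (Γ'.vert x) * Γ.solDeriv z p' x =
        ∑ x ∈ (Finset.univ.map ι₁.endPoint ∪ Finset.univ.map ι₂.endPoint)ᶜ,
          H (Γ.vert x) * Γ.solDeriv z p x := by
      refine Finset.sum_congr rfl fun x hx => ?_
      rw [Finset.mem_compl, Finset.mem_union, not_or] at hx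
      have hx₁ : x.1 ∉ Set.range ι₁.edge := fun ⟨e, he⟩ =>
        hx.1 (Finset.mem_map.2 ⟨(e, x.2), Finset.mem_univ _, Prod.ext he rfl⟩)
      have hx₂ : x.1 ∉ Set.range ι₂.edge := fun ⟨e, he⟩ =>
        hx.2 (Finset.mem_map.2 ⟨(e, x.2), Finset.mem_univ _, Prod.ext he rfl⟩)
      rw [h.vert_eq x hx₁ hx₂, solDeriv_apply, solDeriv_apply, hpp _ hx₁ hx₂]
    have e4 : ∑ x, H (Γ.vert x) * Γ.solDeriv z p x = 0 := by
      rw [← (Γ.mem_solSpace.1 hp).2.2 v trivial, Finset.sum_filter]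
      simp [hH]
    rw [h.sum_eq (ι₂.comp_edge_mem_solSpace hp) hp₁ h₁ H,
      hflip.sum_eq (ι₁.comp_edge_mem_solSpace hp) hp₂ h₂ H, e3, add_left_comm, ← e2, e4] at e1
    rw [← e1, h.solDeriv_eq, Finset.sum_filter]
    simp [hH]

end Swap

end MetricGraph

/-! ### The linear involution interchanging boundary data. -/

namespace MetricGraph

section SwapMap

variable {K U U₁ U₂ D : Type*} [Field K] [AddCommGroup U] [Module K U] [AddCommGroup U₁] [Module K U₁]
  [AddCommGroup U₂] [Module K U₂] [AddCommGroup D] [Module K D]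

/-- `k` need not be injective on `S`, so only a linear choice of preimages is available; its values
must lie in `S` for all arguments. -/
theorem exists_section (k : U →ₗ[K] D) (S : Submodule K U) :
    ∃ s : D →ₗ[K] U, (∀ d, s d ∈ S) ∧ ∀ p ∈ S, k (s (k p)) = k p := by
  obtain ⟨g, hg⟩ := (k.domRestrict S).exists_generalizedInverse
  exact ⟨S.subtype ∘ₗ g, fun d => (g d).2, fun p hp => hg ⟨p, hp⟩⟩

variable {E E₁ E₂ M : Type*} [AddCommGroup M] [Module K M]

/-- Interchanges the boundary data `k₁` and `k₂` of the restrictions to two sets of edges, by means of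
the sections `s₁` and `s₂` of the boundary data. -/
noncomputable def swapMap (j₁ : E₁ ↪ E) (j₂ : E₂ ↪ E) (k₁ : (E₁ → M) →ₗ[K] D) (k₂ : (E₂ → M) →ₗ[K] D)
    (s₁ : D →ₗ[K] (E₁ → M)) (s₂ : D →ₗ[K] (E₂ → M)) : (E → M) →ₗ[K] (E → M) :=
  LinearMap.id + (j₁.extendZero K M ∘ₗ s₁ - j₂.extendZero K M ∘ₗ s₂) ∘ₗ
    (k₂ ∘ₗ LinearMap.funLeft K M j₂ - k₁ ∘ₗ LinearMap.funLeft K M j₁)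

variable (j₁ : E₁ ↪ E) (j₂ : E₂ ↪ E) (k₁ : (E₁ → M) →ₗ[K] D) (k₂ : (E₂ → M) →ₗ[K] D)
    (s₁ : D →ₗ[K] (E₁ → M)) (s₂ : D →ₗ[K] (E₂ → M)) (p : E → M)

theorem swapMap_apply : swapMap j₁ j₂ k₁ k₂ s₁ s₂ p =
    p + (Function.extend j₁ (s₁ (k₂ (p ∘ j₂) - k₁ (p ∘ j₁))) 0 -
      Function.extend j₂ (s₂ (k₂ (p ∘ j₂) - k₁ (p ∘ j₁))) 0) := rfl

theorem swapMap_apply_of_notMem {e : E} (h₁ : e ∉ Set.range j₁) (h₂ : e ∉ Set.range j₂) :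
    swapMap j₁ j₂ k₁ k₂ s₁ s₂ p e = p e := by
  rw [swapMap_apply, Pi.add_apply, Pi.sub_apply, Function.extend_apply' _ _ _ h₁,
    Function.extend_apply' _ _ _ h₂, sub_self, add_zero]

theorem swapMap_comp_left (hj : ∀ e₁ e₂, j₁ e₁ ≠ j₂ e₂) : swapMap j₁ j₂ k₁ k₂ s₁ s₂ p ∘ j₁ =
    p ∘ j₁ + s₁ (k₂ (p ∘ j₂) - k₁ (p ∘ j₁)) := by
  funext e
  rw [swapMap_apply, Function.comp_apply, Pi.add_apply, Pi.sub_apply, j₁.injective.extend_apply,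
    Function.extend_apply' _ _ _ fun ⟨e₂, h⟩ => hj e e₂ h.symm, Pi.zero_apply, sub_zero]
  rfl

theorem swapMap_comp_right (hj : ∀ e₁ e₂, j₁ e₁ ≠ j₂ e₂) : swapMap j₁ j₂ k₁ k₂ s₁ s₂ p ∘ j₂ =
    p ∘ j₂ - s₂ (k₂ (p ∘ j₂) - k₁ (p ∘ j₁)) := by
  funext e
  rw [swapMap_apply, Function.comp_apply, Pi.add_apply, Pi.sub_apply, j₂.injective.extend_apply,
    Function.extend_apply' _ _ _ fun ⟨e₁, h⟩ => hj e₁ e h, Pi.zero_apply, zero_sub, ← sub_eq_add_neg]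
  rfl

variable {j₁ j₂ k₁ k₂ s₁ s₂ p}

/-- Twice interchanging the boundary data gives the identity. -/
theorem swapMap_swapMap
    (h₁ : k₁ (swapMap j₁ j₂ k₁ k₂ s₁ s₂ p ∘ j₁) = k₂ (p ∘ j₂))
    (h₂ : k₂ (swapMap j₁ j₂ k₁ k₂ s₁ s₂ p ∘ j₂) = k₁ (p ∘ j₁)) :
    swapMap j₁ j₂ k₁ k₂ s₁ s₂ (swapMap j₁ j₂ k₁ k₂ s₁ s₂ p) = p := by
  have hs : ∀ q, swapMap j₁ j₂ k₁ k₂ s₁ s₂ q = q + (j₁.extendZero K M ∘ₗ s₁ - j₂.extendZero K M ∘ₗ s₂)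
    (k₂ (q ∘ j₂) - k₁ (q ∘ j₁)) := fun q => rfl
  -- The difference of the data has changed sign, so the second correction cancels the first.
  rw [hs (swapMap j₁ j₂ k₁ k₂ s₁ s₂ p), h₁, h₂, hs p, add_assoc, ← map_add, sub_add_sub_cancel,
    sub_self, map_zero, add_zero]

/-- If two spaces of functions on disjoint sets of edges have the same boundary data, then a linear
involution interchanges these data. -/
theorem exists_swap (hj : ∀ e₁ e₂, j₁ e₁ ≠ j₂ e₂) {S₁ : Submodule K (E₁ → M)} {S₂ : Submodule K (E₂ → M)}
    (h₁₂ : ∀ p ∈ S₁, ∃ q ∈ S₂, k₂ q = k₁ p) (h₂₁ : ∀ q ∈ S₂, ∃ p ∈ S₁, k₁ p = k₂ q) :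
    ∃ T : (E → M) →ₗ[K] (E → M),
      (∀ p e, e ∉ Set.range j₁ → e ∉ Set.range j₂ → T p e = p e) ∧
      ∀ p, p ∘ j₁ ∈ S₁ → p ∘ j₂ ∈ S₂ → T p ∘ j₁ ∈ S₁ ∧ T p ∘ j₂ ∈ S₂ ∧
        k₁ (T p ∘ j₁) = k₂ (p ∘ j₂) ∧ k₂ (T p ∘ j₂) = k₁ (p ∘ j₁) ∧ T (T p) = p := by
  obtain ⟨s₁, hs₁, hks₁⟩ := exists_section k₁ S₁
  obtain ⟨s₂, hs₂, hks₂⟩ := exists_section k₂ S₂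
  refine ⟨swapMap j₁ j₂ k₁ k₂ s₁ s₂, fun p e => swapMap_apply_of_notMem _ _ _ _ _ _ p,
    fun p h₁ h₂ => ?_⟩
  obtain ⟨q₁, hq₁, hd₁⟩ := h₂₁ _ h₂
  obtain ⟨q₂, hq₂, hd₂⟩ := h₁₂ _ h₁
  -- The difference of the data is itself the datum of an element of `S₁`, and likewise of `S₂`, so
  -- both sections reproduce it.
  have e₁ := hks₁ _ (Submodule.sub_mem _ hq₁ h₁)
  have e₂ := hks₂ _ (Submodule.sub_mem _ h₂ hq₂)
  rw [map_sub, hd₁] at e₁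
  rw [map_sub, hd₂] at e₂
  have c₁ := swapMap_comp_left j₁ j₂ k₁ k₂ s₁ s₂ p hj
  have c₂ := swapMap_comp_right j₁ j₂ k₁ k₂ s₁ s₂ p hj
  have h₃ : k₁ (swapMap j₁ j₂ k₁ k₂ s₁ s₂ p ∘ j₁) = k₂ (p ∘ j₂) := by
    rw [c₁, map_add, e₁, add_sub_cancel]
  have h₄ : k₂ (swapMap j₁ j₂ k₁ k₂ s₁ s₂ p ∘ j₂) = k₁ (p ∘ j₁) := by
    rw [c₂, map_sub, e₂, sub_sub_cancel]
  refine ⟨?_, ?_, h₃, h₄, swapMap_swapMap h₃ h₄⟩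
  · rw [c₁]
    exact Submodule.add_mem _ h₁ (hs₁ _)
  · rw [c₂]
    exact Submodule.sub_mem _ h₂ (hs₂ _)

theorem nonempty_linearEquiv_of_involutive {T : U →ₗ[K] U} {S S' : Submodule K U}
    (h : ∀ p ∈ S, T p ∈ S' ∧ T (T p) = p) (h' : ∀ p ∈ S', T p ∈ S ∧ T (T p) = p) :
    Nonempty (S ≃ₗ[K] S') :=
  ⟨.ofLinearMap (T.restrict fun p hp => (h p hp).1) (T.restrict fun p hp => (h' p hp).1)
    (LinearMap.ext fun p => Subtype.ext (h' p p.2).2)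
    (LinearMap.ext fun p => Subtype.ext (h p p.2).2)⟩

end SwapMap

/-! ### The exchanged graph and the conclusion. -/

section Exchange

variable {E V E₁ V₁ E₂ V₂ B : Type*} {Γ Γ' : MetricGraph E V}
  {R₁ : MetricGraph E₁ V₁} {R₂ : MetricGraph E₂ V₂} {c₁ : B ↪ V₁} {c₂ : B ↪ V₂}

theorem IsExchange.solSpace_equiv [Fintype E] [Fintype E₁] [Fintype E₂] [Fintype V₁] [Fintype V₂]
    [Fintype B] {ι₁ : Inclusion R₁ c₁ Γ} {ι₂ : Inclusion R₂ c₂ Γ} {κ₁ : Inclusion R₁ c₁ Γ'}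
    {κ₂ : Inclusion R₂ c₂ Γ'} (h : IsExchange ι₁ ι₂ κ₁ κ₂)
    (hM : ∀ z : ℂ, z.im ≠ 0 → R₁.mFunction c₁ z = R₂.mFunction c₂ z) (z : ℂ) :
    Nonempty (Γ.solSpace ∅ Set.univ z ≃ₗ[ℂ] Γ'.solSpace ∅ Set.univ z) := by
  obtain ⟨T, hoff, hT⟩ := exists_swap h.disjoint
    (fun _ hp => exists_contactData_eq_of_mFunction_eq hM z hp)
    (fun _ hp => exists_contactData_eq_of_mFunction_eq (fun z hz => (hM z hz).symm) z hp)
  refine nonempty_linearEquiv_of_involutive (T := T) (fun p hp => ?_) fun p hp => ?_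
  · obtain ⟨h₁, h₂, h₃, h₄, h₅⟩ := hT p (ι₁.comp_edge_mem_solSpace hp) (ι₂.comp_edge_mem_solSpace hp)
    exact ⟨h.mem_solSpace hp h₁ h₂ h₃ h₄ (hoff p), h₅⟩
  · have h₆ := hoff p
    -- The subgraphs keep their edges, so the same `T` serves for the way back.
    rw [h.edge_left, h.edge_right] at hT h₆
    obtain ⟨h₁, h₂, h₃, h₄, h₅⟩ := hT p (κ₁.comp_edge_mem_solSpace hp) (κ₂.comp_edge_mem_solSpace hp)
    exact ⟨h.symm.mem_solSpace hp h₁ h₂ h₃ h₄ h₆, h₅⟩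

variable (ι₁ : Inclusion R₁ c₁ Γ) (ι₂ : Inclusion R₂ c₂ Γ)

theorem exchangeVert_of_not_atContact {x : E × Bool} (h₁ : ¬ ∃ b, ι₁.AtContact x b)
    (h₂ : ¬ ∃ b, ι₂.AtContact x b) : exchangeVert ι₁ ι₂ x = Γ.vert x := by
  rw [exchangeVert, dif_neg h₁, dif_neg h₂]

theorem Inclusion.not_atContact_of_notMem {x : E × Bool} (hx : x.1 ∉ Set.range ι₁.edge) :
    ¬ ∃ b, ι₁.AtContact x b := by
  rintro ⟨b, e, s, rfl, -⟩
  exact hx ⟨e, rfl⟩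

theorem Inclusion.not_atContact_of_inner {e : E₁} {s : Bool} (h : R₁.vert (e, s) ∉ Set.range c₁) :
    ¬ ∃ b, ι₁.AtContact (ι₁.edge e, s) b := by
  rintro ⟨b, e', s', hx, hb⟩
  obtain ⟨h1, rfl⟩ := Prod.mk.inj hx
  obtain rfl := ι₁.edge.injective h1
  exact h ⟨b, hb.symm⟩

variable (hdisj : ∀ e₁ e₂, ι₁.edge e₁ ≠ ι₂.edge e₂)

/-- The first subgraph after the exchange. -/
noncomputable def exchangeInclusionLeft : Inclusion R₁ c₁ (exchange ι₁ ι₂ hdisj) where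
  edge := ι₁.edge
  length_edge := ι₁.length_edge
  vertex := Function.extend c₁ (fun b => ι₂.vertex (c₂ b)) ι₁.vertex
  vert_edge e s := by
    change exchangeVert ι₁ ι₂ (ι₁.edge e, s) = _
    by_cases h : R₁.vert (e, s) ∈ Set.range c₁
    · obtain ⟨b, hb⟩ := h
      rw [exchangeVert_left ι₁ ι₂ ⟨e, s, rfl, hb.symm⟩, ← hb, c₁.injective.extend_apply]
    · rw [exchangeVert_of_not_atContact ι₁ ι₂ (ι₁.not_atContact_of_inner h)
        (ι₂.not_atContact_of_notMem fun ⟨e₂, h⟩ => hdisj e e₂ h.symm), ι₁.vert_edge,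
        Function.extend_apply' _ _ _ h]
  inner w hw x hx := by
    rw [Function.extend_apply' _ _ _ hw] at hx
    change exchangeVert ι₁ ι₂ x = _ at hx
    by_cases h₁ : ∃ b, ι₁.AtContact x b
    · obtain ⟨b, hb⟩ := h₁
      -- An end of `R₂` at `c₂ b` lies in the vertex to which `x` was moved. Were this an inner
      -- vertex of `R₁`, that end would belong to `R₁`.
      obtain ⟨y, hy⟩ := R₂.vert_surjective (c₂ b)
      rw [exchangeVert_left ι₁ ι₂ hb, ← hy, ← ι₂.vert_edge] at hx
      obtain ⟨e, s, he, -⟩ := ι₁.inner w hw _ hx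
      exact (hdisj _ _ (congrArg Prod.fst he)).elim
    by_cases h₂ : ∃ b, ι₂.AtContact x b
    · obtain ⟨b, hb⟩ := h₂
      obtain ⟨y, hy⟩ := R₁.vert_surjective (c₁ b)
      rw [exchangeVert_right ι₁ ι₂ hdisj hb, ← hy, ← ι₁.vert_edge] at hx
      obtain ⟨e, s, he, hv⟩ := ι₁.inner w hw _ hx
      obtain ⟨h1, rfl⟩ := Prod.mk.inj he
      obtain rfl := ι₁.edge.injective h1
      exact (hw ⟨b, hy.symm.trans hv⟩).elim
    · rw [exchangeVert_of_not_atContact ι₁ ι₂ h₁ h₂] at hx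
      exact ι₁.inner w hw x hx

/-- The second subgraph after the exchange. -/
noncomputable def exchangeInclusionRight : Inclusion R₂ c₂ (exchange ι₁ ι₂ hdisj) where
  edge := ι₂.edge
  length_edge := ι₂.length_edge
  vertex := Function.extend c₂ (fun b => ι₁.vertex (c₁ b)) ι₂.vertex
  vert_edge e s := by
    change exchangeVert ι₁ ι₂ (ι₂.edge e, s) = _
    by_cases h : R₂.vert (e, s) ∈ Set.range c₂
    · obtain ⟨b, hb⟩ := h
      rw [exchangeVert_right ι₁ ι₂ hdisj ⟨e, s, rfl, hb.symm⟩, ← hb, c₂.injective.extend_apply]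
    · rw [exchangeVert_of_not_atContact ι₁ ι₂ (ι₁.not_atContact_of_notMem fun ⟨e₁, h⟩ => hdisj e₁ e h)
        (ι₂.not_atContact_of_inner h), ι₂.vert_edge, Function.extend_apply' _ _ _ h]
  inner w hw x hx := by
    rw [Function.extend_apply' _ _ _ hw] at hx
    change exchangeVert ι₁ ι₂ x = _ at hx
    by_cases h₁ : ∃ b, ι₁.AtContact x b
    · obtain ⟨b, hb⟩ := h₁
      obtain ⟨y, hy⟩ := R₂.vert_surjective (c₂ b)
      rw [exchangeVert_left ι₁ ι₂ hb, ← hy, ← ι₂.vert_edge] at hx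
      obtain ⟨e, s, he, hv⟩ := ι₂.inner w hw _ hx
      obtain ⟨h1, rfl⟩ := Prod.mk.inj he
      obtain rfl := ι₂.edge.injective h1
      exact (hw ⟨b, hy.symm.trans hv⟩).elim
    by_cases h₂ : ∃ b, ι₂.AtContact x b
    · obtain ⟨b, hb⟩ := h₂
      obtain ⟨y, hy⟩ := R₁.vert_surjective (c₁ b)
      rw [exchangeVert_right ι₁ ι₂ hdisj hb, ← hy, ← ι₁.vert_edge] at hx
      obtain ⟨e, s, he, -⟩ := ι₂.inner w hw _ hx
      exact (hdisj _ _ (congrArg Prod.fst he).symm).elim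
    · rw [exchangeVert_of_not_atContact ι₁ ι₂ h₁ h₂] at hx
      exact ι₂.inner w hw x hx

theorem isExchange_exchange : IsExchange ι₁ ι₂ (exchangeInclusionLeft ι₁ ι₂ hdisj)
    (exchangeInclusionRight ι₁ ι₂ hdisj) where
  length_eq := rfl
  disjoint := hdisj
  edge_left := rfl
  edge_right := rfl
  vertex_left b := (c₂.injective.extend_apply (fun b => ι₁.vertex (c₁ b)) ι₂.vertex b).symm
  vertex_right b := (c₁.injective.extend_apply (fun b => ι₂.vertex (c₂ b)) ι₁.vertex b).symm
  vert_eq _ h₁ h₂ := (exchangeVert_of_not_atContact ι₁ ι₂ (ι₁.not_atContact_of_notMem h₁)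
    (ι₂.not_atContact_of_notMem h₂)).symm

end Exchange

end MetricGraph

theorem mainTheorem1 {E V E₁ V₁ E₂ V₂ B : Type*} [Fintype E] [Fintype E₁] [Fintype E₂]
    (Γ : MetricGraph E V) (R₁ : MetricGraph E₁ V₁) (R₂ : MetricGraph E₂ V₂)
    (c₁ : B ↪ V₁) (c₂ : B ↪ V₂)
    (ι₁ : MetricGraph.Inclusion R₁ c₁ Γ) (ι₂ : MetricGraph.Inclusion R₂ c₂ Γ)
    (hdisj : ∀ e₁ e₂, ι₁.edge e₁ ≠ ι₂.edge e₂)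
    (hM : ∀ z : ℂ, z.im ≠ 0 → R₁.mFunction c₁ z = R₂.mFunction c₂ z) :
    Γ.Isospectral (MetricGraph.exchange ι₁ ι₂ hdisj) := by
  have : Finite V₁ := Finite.of_surjective _ R₁.vert_surjective
  have : Finite V₂ := Finite.of_surjective _ R₂.vert_surjective
  have : Finite B := Finite.of_injective _ c₁.injective
  have := Fintype.ofFinite V₁
  have := Fintype.ofFinite V₂
  have := Fintype.ofFinite B
  exact MetricGraph.isospectral_of_solSpace_equiv
    ((MetricGraph.isExchange_exchange ι₁ ι₂ hdisj).solSpace_equiv hM)
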